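/- Let $d\ge 1$, $K>0$, and let $U$ be a real polynomial of degree $4$ with strictly positive leading coefficient and $U\ge 0$ on $\mathbb R$. For $i,j\in\mathbb Z^d$ put $|i-j|=\sum_{\ell=1}^d|i_\ell-j_\ell|$. Let $\mathcal X$ be the set of all configurations $x=\{x_i\}_{i\in\mathbb Z^d}=\{(q_i,p_i)\}_{i\in\mathbb Z^d}$ with $(q_i,p_i)\in\mathbb R^2$, and consider the infinite system $$\dot q_i(t)=p_i(t),\qquad \dot p_i(t)=-U'(q_i(t))-K\sum_{j:|j-i|=1}\big(q_i(t)-q_j(t)\big),\qquad i\in\mathbb Z^d. \tag{1}$$ For $\nu\in\mathbb Z^d$ and $k\in\mathbb N$ let $\Lambda_{\nu,k}$ be the cube in $\mathbb Z^d$ of center $\nu$ and side $2k+1$, and let $$W_{\nu,k}(x)=\sum_{i\in\Lambda_{\nu,k}}\Big\{\frac{p_i^2}{2}+U(q_i)+1\Big\}+\sum_{i,j\in\Lambda_{\nu,k},\,|j-i|=1}\frac K4(q_i-q_j)^2$$ (the last sum is over ordered pairs), $$Q(x)=\sup_{\nu\in\mathbb Z^d}\ \sup_{k>\log^{1/d}(e+|\nu|)}\frac{W_{\nu,k}(x)}{(2k+1)^d},\qquad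 \mathcal X_0=\{x\in\mathcal X: Q(x)<\infty\}.$$ Then there exists a one-parameter group of transformations $\Phi_t:\mathcal X_0\to\mathcal X_0$, $t\in\mathbb R$ (that is, $\Phi_0=\mathrm{id}$ and $\Phi_{s+t}=\Phi_s\circ\Phi_t$), such that for every $x\in\mathcal X_0$ the map $t\mapsto\Phi_t(x)$, $t\in\mathbb R$, is the unique global solution of (1) with values in $\mathcal X_0$ and initial condition $x$ at $t=0$. Moreover, for all $i,j\in\mathbb Z^d$ and $t\in\mathbb R$, $\Phi_t(x)_j\in\mathbb R^2$ is a differentiable function of $x_i=(q_i,p_i)\in\mathbb R^2$ (the other coordinates of $x\in\mathcal X_0$ being fixed). Finally, there exists a constant $C_0>0$, depending only on $d$, $K$ and $U$, such that for all $x\in\mathcal X_0$ and $t\in\mathbb R$ $$Q(\Phi_t(x))\le C_0\Big\{Q(x)\log[e+Q(x)]+t^4\Big\}.$$ -/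

import Mathlib

open Polynomial

namespace Anharmonic

/-- The lattice `ℤ^d`. -/
abbrev Site (d : ℕ) : Type := Fin d → ℤ

/-- The state space: at each site a position `q_i = (x i).1` and a momentum `p_i = (x i).2`. -/
abbrev Config (d : ℕ) : Type := Site d → ℝ × ℝ

/-- The distance `|i - j| = ∑ ℓ, |i_ℓ - j_ℓ|`. -/
def siteDist {d : ℕ} (i j : Site d) : ℤ := ∑ l, |i l - j l|

/-- The cube of center `ν` and side `2k+1`. -/
noncomputable def cube {d : ℕ} (ν : Site d) (k : ℕ) : Finset (Site d) :=
  Finset.Icc (fun l => ν l - (k : ℤ)) (fun l => ν l + (k : ℤ))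

/-- The finite set of sites at distance `1` from `i` (see `mem_nbrs`). -/
noncomputable def nbrs {d : ℕ} (i : Site d) : Finset (Site d) :=
  (cube i 1).filter (fun j => siteDist j i = 1)

theorem mem_cube {d : ℕ} {ν j : Site d} {k : ℕ} :
    j ∈ cube ν k ↔ ∀ l, |j l - ν l| ≤ (k : ℤ) := by
  simp only [cube, Finset.mem_Icc, Pi.le_def, abs_le]
  constructor
  · rintro ⟨h1, h2⟩ l
    have := h1 l
    have := h2 l
    constructor <;> linarith
  · intro h
    constructor <;> intro l <;> have := h l <;> linarith [this.1, this.2]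

theorem mem_nbrs {d : ℕ} {i j : Site d} : j ∈ nbrs i ↔ siteDist j i = 1 := by
  simp only [nbrs, Finset.mem_filter, mem_cube, and_iff_right_iff_imp]
  intro h l
  have : |j l - i l| ≤ siteDist j i :=
    Finset.single_le_sum (f := fun l => |j l - i l|) (fun _ _ => abs_nonneg _) (Finset.mem_univ l)
  simpa [h] using this

/-- The force `F_i(x) = -U'(q_i) - K ∑_{|j-i|=1} (q_i - q_j)`. -/
noncomputable def force {d : ℕ} (K : ℝ) (U : ℝ[X]) (i : Site d) (x : Config d) : ℝ :=
  -(derivative U).eval (x i).1 - K * ∑ j ∈ nbrs i, ((x i).1 - (x j).1)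

/-- `x` is a global solution of `q̇_i = p_i`, `ṗ_i = F_i(x)`, `i ∈ ℤ^d`. -/
def IsSolution {d : ℕ} (K : ℝ) (U : ℝ[X]) (x : ℝ → Config d) : Prop :=
  ∀ (t : ℝ) (i : Site d),
    HasDerivAt (fun s => (x s i).1) (x t i).2 t ∧
    HasDerivAt (fun s => (x s i).2) (force K U i (x t)) t

/-- The local energy `W_{ν,k}(x)`; the interaction is summed over ordered pairs `(i, j)`. -/
noncomputable def localEnergy {d : ℕ} (K : ℝ) (U : ℝ[X]) (ν : Site d) (k : ℕ)
    (x : Config d) : ℝ :=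
  ∑ i ∈ cube ν k, ((x i).2 ^ 2 / 2 + U.eval (x i).1 + 1) +
    ∑ i ∈ cube ν k, ∑ j ∈ (cube ν k).filter (fun j => siteDist j i = 1),
      K / 4 * ((x i).1 - (x j).1) ^ 2

/-- `Q(x) = sup_ν sup_{k > log^{1/d}(e+|ν|)} W_{ν,k}(x) / (2k+1)^d`, possibly `+∞`. -/
noncomputable def Q {d : ℕ} (K : ℝ) (U : ℝ[X]) (x : Config d) : EReal :=
  ⨆ (ν : Site d) (k : ℕ)
    (_ : Real.log (Real.exp 1 + (siteDist ν 0 : ℝ)) ^ (1 / (d : ℝ)) < (k : ℝ)),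
    ((localEnergy K U ν k x / (2 * (k : ℝ) + 1) ^ d : ℝ) : EReal)

/-- The set of configurations with `Q(x) < ∞`. -/
def X₀ (d : ℕ) (K : ℝ) (U : ℝ[X]) : Set (Config d) := {x | Q K U x < ⊤}

theorem siteDist_comm {d : ℕ} (i j : Site d) : siteDist i j = siteDist j i := by
  simp only [siteDist, abs_sub_comm]

theorem sum_le_sum_add {ι : Type*} (s S : Finset ι) (f g : ι → ℝ)
    (h : ∀ a, a ∉ S → f a ≤ g a) :
    ∑ a ∈ s, f a ≤ ∑ a ∈ s, g a + ∑ a ∈ S, |f a - g a| := by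
  classical
  rw [← sub_le_iff_le_add', ← Finset.sum_sub_distrib]
  calc ∑ a ∈ s, (f a - g a) ≤ ∑ a ∈ s, (if a ∈ S then |f a - g a| else 0) := by
        refine Finset.sum_le_sum fun a _ => ?_
        split_ifs with ha
        · exact le_abs_self _
        · linarith [h a ha]
    _ = ∑ a ∈ s ∩ S, |f a - g a| := by rw [Finset.sum_ite_mem]
    _ ≤ ∑ a ∈ S, |f a - g a| :=
        Finset.sum_le_sum_of_subset_of_nonneg Finset.inter_subset_right
          (fun _ _ _ => abs_nonneg _)

theorem localEnergy_update_le {d : ℕ} (K : ℝ) (U : ℝ[X]) (x : Config d) (i : Site d)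
    (y : ℝ × ℝ) : ∃ D : ℝ, 0 ≤ D ∧ ∀ (ν : Site d) (k : ℕ),
      localEnergy K U ν k (Function.update x i y) ≤ localEnergy K U ν k x + D := by
  classical
  set z := Function.update x i y with hz
  have hzx : ∀ a, a ≠ i → z a = x a := fun a ha => Function.update_of_ne ha _ _
  let e : Config d → Site d → ℝ := fun w a => (w a).2 ^ 2 / 2 + U.eval (w a).1 + 1
  let v : Config d → Site d → Site d → ℝ := fun w a b => K / 4 * ((w a).1 - (w b).1) ^ 2
  let D₁ := ∑ a ∈ {i}, |e z a - e x a|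
  let D₂ := ∑ a ∈ insert i (nbrs i), ∑ b ∈ nbrs a, |v z a b - v x a b|
  refine ⟨D₁ + D₂, by positivity, fun ν k => ?_⟩
  have h1 : ∑ a ∈ cube ν k, e z a ≤ ∑ a ∈ cube ν k, e x a + D₁ := by
    refine sum_le_sum_add _ _ _ _ fun a ha => ?_
    have : z a = x a := hzx a (by simpa using ha)
    simp [e, this]
  let N : Site d → Finset (Site d) := fun a => (cube ν k).filter (fun j => siteDist j a = 1)
  have h2 : ∑ a ∈ cube ν k, ∑ b ∈ N a, v z a b ≤
      ∑ a ∈ cube ν k, ∑ b ∈ N a, v x a b + D₂ := by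
    refine (sum_le_sum_add _ (insert i (nbrs i)) _ (fun a => ∑ b ∈ N a, v x a b) ?_).trans ?_
    · intro a ha
      simp only [Finset.mem_insert, not_or] at ha
      refine le_of_eq (Finset.sum_congr rfl fun b hb => ?_)
      have hb' : b ≠ i := by
        rintro rfl
        have := (Finset.mem_filter.1 hb).2
        exact ha.2 (mem_nbrs.2 (by rw [siteDist_comm]; exact this))
      simp only [v, hzx a ha.1, hzx b hb']
    · refine add_le_add le_rfl (Finset.sum_le_sum fun a _ => ?_)
      rw [← Finset.sum_sub_distrib]
      refine (Finset.abs_sum_le_sum_abs _ _).trans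
        (Finset.sum_le_sum_of_subset_of_nonneg ?_ fun _ _ _ => abs_nonneg _)
      intro b hb
      exact mem_nbrs.2 (Finset.mem_filter.1 hb).2
  have := add_le_add h1 h2
  simp only [localEnergy]
  simp only [e, v, N] at this
  linarith

/-- Changing a configuration of `X₀` at one site gives a configuration of `X₀`. -/
theorem update_mem_X₀ {d : ℕ} {K : ℝ} {U : ℝ[X]} {x : Config d} (hx : x ∈ X₀ d K U)
    (i : Site d) (y : ℝ × ℝ) : Function.update x i y ∈ X₀ d K U := by
  obtain ⟨D, hD, h⟩ := localEnergy_update_le K U x i y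
  have hx' : Q K U x < ⊤ := hx
  have key : Q K U (Function.update x i y) ≤ Q K U x + (D : EReal) := by
    refine iSup_le fun ν => iSup_le fun k => iSup_le fun hk => ?_
    have hpos : (1 : ℝ) ≤ (2 * (k : ℝ) + 1) ^ d :=
      one_le_pow₀ (by have : (0 : ℝ) ≤ k := Nat.cast_nonneg k; linarith)
    have h1 : localEnergy K U ν k (Function.update x i y) / (2 * (k : ℝ) + 1) ^ d ≤
        localEnergy K U ν k x / (2 * (k : ℝ) + 1) ^ d + D := by
      calc _ ≤ (localEnergy K U ν k x + D) / (2 * (k : ℝ) + 1) ^ d := by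
            gcongr
            exact h ν k
        _ ≤ _ := by
            rw [add_div]
            gcongr
            exact div_le_self hD hpos
    refine (EReal.coe_le_coe_iff.2 h1).trans ?_
    rw [EReal.coe_add]
    refine add_le_add ?_ le_rfl
    exact le_iSup_of_le ν (le_iSup_of_le k (le_iSup_of_le hk le_rfl))
  exact key.trans_lt (EReal.add_lt_top hx'.ne (EReal.coe_ne_top D))

/-- The configuration of `X₀` obtained from `x` by replacing `x_i` by `y`. -/
noncomputable def updateAt {d : ℕ} {K : ℝ} {U : ℝ[X]} (x : X₀ d K U) (i : Site d)
    (y : ℝ × ℝ) : X₀ d K U :=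
  ⟨Function.update x.1 i y, update_mem_X₀ x.2 i y⟩

end Anharmonic

/-!
Weight the energy of a finite volume by a function `w` of the site which is halved at most across a
bond and decays exponentially on the scale `k` away from a cube of side `2k+1`. In its time
derivative each bond contributes at most `|w_j - w_i| |q_i - q_j| |p_i| ≤ w_i |q_i - q_j| |p_i|`.
Since the potential is at least quartic, `|q p|` is at most `(p² + q⁴) / T + T³` up to a constant,
so that over a time interval of length `T` the weighted energy grows at most by a constant factor
and by a multiple of `T⁴` per site: this bounds `Q` in finite volume, uniformly in the volume.

On configurations with bounded `Q` the energy of the site `j` is at most of order `log (e + |j|)`,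
and so is the Lipschitz constant of the force on it. A weight `(e + |j|) ^ (a + lam t)` compensates
this growth in Grönwall's inequality, whence stability, the limit of infinite volume, and uniqueness
among solutions with locally bounded `Q`. Every solution in `X₀` is of this kind: by Baire's theorem
`Q` is bounded on some relatively open part of the set of times near which it is not locally
bounded, and the energy estimate propagates this bound across the adjacent intervals, so that this
set is empty.

The second differences of the flow with respect to `x_i` obey the linearized inequality with a
quadratic error. Together with the Lipschitz bound this makes the dyadic difference quotients
converge to a linear map, uniformly enough to give differentiability without solving the variational
equation.
-/

namespace Anharmonic

open Filter Topology Set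

/-! ### Growth of the potential -/

theorem exists_abs_eval_le_mul {P V : ℝ[X]} (hPV : P.degree ≤ V.degree)
    (hV : ∀ q : ℝ, 0 < V.eval q) : ∃ C : ℝ, ∀ q : ℝ, |P.eval q| ≤ C * V.eval q := by
  have hcomp : (P.comp (-X)).degree ≤ (V.comp (-X)).degree := by simpa using hPV
  have hbot : (fun q => P.eval q) =O[atBot] fun q => V.eval q := by
    simpa [Function.comp_def] using
      (isBigO_atTop_of_degree_le _ _ hcomp).comp_tendsto tendsto_neg_atBot_atTop
  have hO : (fun q => P.eval q) =O[cocompact ℝ] fun q => V.eval q := by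
    rw [cocompact_eq_atBot_atTop]
    exact hbot.sup (isBigO_atTop_of_degree_le _ _ hPV)
  obtain ⟨C₁, hC₁⟩ := hO.bound
  obtain ⟨S, hS, hSC⟩ := mem_cocompact.1 hC₁
  obtain ⟨C₂, hC₂⟩ := hS.exists_bound_of_continuousOn (f := fun q => P.eval q / V.eval q)
    (by fun_prop (disch := exact fun q _ => (hV q).ne'))
  refine ⟨max C₁ C₂, fun q => ?_⟩
  by_cases hq : q ∈ S
  · have h := hC₂ q hq
    rw [norm_div, Real.norm_eq_abs, Real.norm_of_nonneg (hV q).le, div_le_iff₀ (hV q)] at h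
    exact h.trans (mul_le_mul_of_nonneg_right (le_max_right _ _) (hV q).le)
  · have h : ‖P.eval q‖ ≤ C₁ * ‖V.eval q‖ := hSC hq
    rw [Real.norm_eq_abs, Real.norm_of_nonneg (hV q).le] at h
    exact h.trans (mul_le_mul_of_nonneg_right (le_max_left _ _) (hV q).le)

theorem exists_abs_eval_le_one_add_pow {P : ℝ[X]} {n : ℕ} (hP : P.natDegree ≤ n) :
    ∃ C : ℝ, 0 ≤ C ∧ ∀ q : ℝ, |P.eval q| ≤ C * (1 + |q| ^ n) := by
  refine ⟨∑ i ∈ Finset.range (n + 1), |P.coeff i|, by positivity, fun q => ?_⟩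
  rw [eval_eq_sum_range' (Nat.lt_succ_of_le hP), Finset.sum_mul]
  refine (Finset.abs_sum_le_sum_abs _ _).trans (Finset.sum_le_sum fun i hi => ?_)
  have hpow : |q| ^ i ≤ 1 + |q| ^ n := by
    rcases le_total |q| 1 with hq | hq
    · exact (pow_le_one₀ (abs_nonneg q) hq).trans (le_add_of_nonneg_right (by positivity))
    · exact (pow_le_pow_right₀ hq (Finset.mem_range_succ_iff.1 hi)).trans
        (le_add_of_nonneg_left zero_le_one)
  rw [abs_mul, abs_pow]
  gcongr

theorem eventually_abs_eval_le_add {P V : ℝ[X]} (hPV : P.natDegree ≤ V.natDegree)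
    (hV : ∀ q : ℝ, 0 < V.eval q) : ∀ᶠ C in atTop, ∀ q r : ℝ, ∀ ξ ∈ uIcc q r,
      |P.eval ξ| ≤ C * (V.eval q + V.eval r) := by
  have hV0 : V ≠ 0 := by
    rintro rfl
    simpa using hV 0
  obtain ⟨A, hA⟩ := exists_abs_eval_le_mul (P := 1) (V := V)
    (by rw [degree_one]; exact zero_le_degree_iff.2 hV0) hV
  obtain ⟨B, hB⟩ := exists_abs_eval_le_mul (P := X ^ V.natDegree) (V := V)
    (by rw [degree_X_pow, degree_eq_natDegree hV0]) hV
  simp only [eval_one, abs_one, eval_pow, eval_X, abs_pow] at hA hB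
  obtain ⟨D, hD, hP⟩ := exists_abs_eval_le_one_add_pow hPV
  filter_upwards [eventually_ge_atTop (D * (A + B))] with C hC q r ξ hξ
  have hmax : |ξ| ≤ max |q| |r| := by
    rcases le_total q r with h | h
    · rw [uIcc_of_le h] at hξ
      exact abs_le_max_abs_abs hξ.1 hξ.2
    · rw [uIcc_of_ge h] at hξ
      exact (abs_le_max_abs_abs hξ.1 hξ.2).trans (max_comm _ _).le
  have hpow : |ξ| ^ V.natDegree ≤ |q| ^ V.natDegree + |r| ^ V.natDegree := by
    rcases le_max_iff.1 hmax with h | h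
    · exact (pow_le_pow_left₀ (abs_nonneg ξ) h _).trans (le_add_of_nonneg_right (by positivity))
    · exact (pow_le_pow_left₀ (abs_nonneg ξ) h _).trans (le_add_of_nonneg_left (by positivity))
  have hqr : 0 < V.eval q + V.eval r := add_pos (hV q) (hV r)
  calc |P.eval ξ| ≤ D * (1 + |ξ| ^ V.natDegree) := hP ξ
    _ ≤ D * ((A + B) * (V.eval q + V.eval r)) := by
        gcongr
        linarith [hA q, hA r, hB q, hB r]
    _ ≤ C * (V.eval q + V.eval r) := by
        rw [← mul_assoc]
        gcongr

theorem abs_eval_sub_le_of_abs_derivative_le {P : ℝ[X]} {q r B : ℝ}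
    (hB : ∀ ξ ∈ uIcc q r, |(derivative P).eval ξ| ≤ B) :
    |P.eval r - P.eval q| ≤ B * |r - q| :=
  (convex_uIcc q r).norm_image_sub_le_of_norm_hasDerivWithin_le
    (fun ξ _ => (P.hasDerivAt ξ).hasDerivWithinAt) hB left_mem_uIcc right_mem_uIcc

theorem abs_eval_taylor_le_of_abs_derivative_le {P : ℝ[X]} {q r B : ℝ}
    (hB : ∀ ξ ∈ uIcc q r, |(derivative (derivative P)).eval ξ| ≤ B) :
    |P.eval r - P.eval q - (derivative P).eval q * (r - q)| ≤ B * (r - q) ^ 2 := by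
  have hB0 : 0 ≤ B := (abs_nonneg _).trans (hB q left_mem_uIcc)
  have hslope : ∀ ξ ∈ uIcc q r,
      |(derivative (P - C ((derivative P).eval q) * X)).eval ξ| ≤ B * |r - q| := fun ξ hξ => by
    have h := abs_eval_sub_le_of_abs_derivative_le (P := derivative P) (q := q) (r := ξ)
      fun η hη => hB η (uIcc_subset_uIcc left_mem_uIcc hξ hη)
    have hdist : |ξ - q| ≤ |r - q| := abs_sub_left_of_mem_uIcc hξ
    simpa using h.trans (mul_le_mul_of_nonneg_left hdist hB0)
  have h := abs_eval_sub_le_of_abs_derivative_le hslope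
  rw [mul_assoc, abs_mul_abs_self] at h
  convert h using 2
  · simp only [eval_sub, eval_mul, eval_C, eval_X]
    ring
  · ring

/-- The energy `p² / 2 + U(q) + 1` of a single oscillator in the state `z = (q, p)`. -/
noncomputable def siteEnergy (U : ℝ[X]) (z : ℝ × ℝ) : ℝ := z.2 ^ 2 / 2 + U.eval z.1 + 1

theorem continuous_siteEnergy (U : ℝ[X]) : Continuous (siteEnergy U) := by
  unfold siteEnergy
  fun_prop

/-- The consequences of `U ≥ 0` and `deg U ≥ 4` on which the dynamics depends: the state and the
first two derivatives of `U'` are controlled by the energy of a single oscillator. A single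
constant `c` serves for all the estimates. -/
structure GrowthBounds (U : ℝ[X]) (c : ℝ) : Prop where
  one_le : 1 ≤ c
  eval_nonneg : ∀ q : ℝ, 0 ≤ U.eval q
  pow_four_le : ∀ z : ℝ × ℝ, z.1 ^ 4 ≤ c * siteEnergy U z
  abs_deriv_le : ∀ z : ℝ × ℝ, |(derivative U).eval z.1| ≤ c * siteEnergy U z
  abs_deriv_deriv_le : ∀ z : ℝ × ℝ, |(derivative (derivative U)).eval z.1| ≤ c * siteEnergy U z
  abs_deriv_sub_le : ∀ z w : ℝ × ℝ, |(derivative U).eval z.1 - (derivative U).eval w.1| ≤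
    c * (siteEnergy U z + siteEnergy U w) * |z.1 - w.1|
  abs_deriv_taylor_le : ∀ z w : ℝ × ℝ, |(derivative U).eval w.1 - (derivative U).eval z.1 -
    (derivative (derivative U)).eval z.1 * (w.1 - z.1)| ≤
      c * (siteEnergy U z + siteEnergy U w) * (w.1 - z.1) ^ 2

namespace GrowthBounds

variable {U : ℝ[X]} {c : ℝ}

theorem one_le_siteEnergy (hc : GrowthBounds U c) (z : ℝ × ℝ) : 1 ≤ siteEnergy U z := by
  have := hc.eval_nonneg z.1
  unfold siteEnergy
  linarith [sq_nonneg z.2]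

theorem siteEnergy_nonneg (hc : GrowthBounds U c) (z : ℝ × ℝ) : 0 ≤ siteEnergy U z :=
  zero_le_one.trans (hc.one_le_siteEnergy z)

theorem siteEnergy_le_mul (hc : GrowthBounds U c) (z : ℝ × ℝ) :
    siteEnergy U z ≤ c * siteEnergy U z :=
  le_mul_of_one_le_left (hc.siteEnergy_nonneg z) hc.one_le

theorem sq_le (hc : GrowthBounds U c) (z : ℝ × ℝ) : z.1 ^ 2 ≤ c * siteEnergy U z := by
  have := hc.pow_four_le z
  have := (hc.one_le_siteEnergy z).trans (hc.siteEnergy_le_mul z)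
  nlinarith [sq_nonneg (z.1 ^ 2 - 1)]

theorem sq_sub_le (hc : GrowthBounds U c) (z w : ℝ × ℝ) :
    (z.1 - w.1) ^ 2 ≤ 2 * c * (siteEnergy U z + siteEnergy U w) := by
  have := hc.sq_le z
  have := hc.sq_le w
  linarith [sq_nonneg (z.1 + w.1)]

theorem norm_le (hc : GrowthBounds U c) (z : ℝ × ℝ) : ‖z‖ ≤ c * siteEnergy U z := by
  have hE := hc.siteEnergy_le_mul z
  refine max_le ?_ ?_ <;> rw [Real.norm_eq_abs]
  · have := hc.sq_le z
    have := hc.one_le_siteEnergy z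
    nlinarith [sq_nonneg (|z.1| - 1), sq_abs z.1]
  · have := hc.eval_nonneg z.1
    refine le_trans ?_ hE
    unfold siteEnergy
    nlinarith [sq_nonneg (|z.2| - 1), sq_abs z.2]

end GrowthBounds

theorem exists_growthBounds {U : ℝ[X]} (hdeg : 4 ≤ U.natDegree) (hU : ∀ q : ℝ, 0 ≤ U.eval q) :
    ∃ c : ℝ, GrowthBounds U c := by
  set V : ℝ[X] := U + C 1
  have hV : ∀ q : ℝ, 0 < V.eval q := fun q => by
    simpa [V] using add_pos_of_nonneg_of_pos (hU q) one_pos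
  have hVE : ∀ z : ℝ × ℝ, V.eval z.1 ≤ siteEnergy U z := fun z => by
    simp only [V, siteEnergy, eval_add, eval_C]
    linarith [sq_nonneg z.2]
  have hVdeg : V.natDegree = U.natDegree := natDegree_add_C
  have hder : ∀ k, (derivative^[k] U).natDegree ≤ V.natDegree := fun k =>
    (natDegree_iterate_derivative U k).trans ((Nat.sub_le _ _).trans hVdeg.ge)
  have hX : (X ^ 4 : ℝ[X]).natDegree ≤ V.natDegree := by rwa [natDegree_X_pow, hVdeg]
  obtain ⟨B, ⟨hX, h', h'', h'''⟩, hB⟩ := ((eventually_abs_eval_le_add hX hV).and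
    ((eventually_abs_eval_le_add (hder 1) hV).and ((eventually_abs_eval_le_add (hder 2) hV).and
      (eventually_abs_eval_le_add (hder 3) hV))) |>.and (eventually_ge_atTop 1)).exists
  have hpair : ∀ z w : ℝ × ℝ, B * (V.eval z.1 + V.eval w.1) ≤
      2 * B * (siteEnergy U z + siteEnergy U w) := fun z w => by
    have := mul_le_mul_of_nonneg_left (add_le_add (hVE z) (hVE w)) (zero_le_one.trans hB)
    have := mul_nonneg (zero_le_one.trans hB) (add_pos (hV z.1) (hV w.1)).le
    linarith
  have hsingle : ∀ z : ℝ × ℝ, B * (V.eval z.1 + V.eval z.1) ≤ 2 * B * siteEnergy U z := fun z => by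
    have := mul_le_mul_of_nonneg_left (hVE z) (zero_le_one.trans hB)
    linarith
  refine ⟨2 * B, ?_, hU, fun z => ?_, fun z => (h' _ _ _ left_mem_uIcc).trans (hsingle z),
    fun z => (h'' _ _ _ left_mem_uIcc).trans (hsingle z), fun z w => ?_, fun z w => ?_⟩
  · linarith
  · have h := (le_abs_self _).trans (hX z.1 z.1 z.1 left_mem_uIcc)
    rw [eval_pow, eval_X] at h
    exact h.trans (hsingle z)
  · rw [add_comm (siteEnergy U z)]
    exact (abs_eval_sub_le_of_abs_derivative_le (h'' _ _)).trans
      (mul_le_mul_of_nonneg_right (hpair w z) (abs_nonneg _))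
  · exact (abs_eval_taylor_le_of_abs_derivative_le (h''' _ _)).trans
      (mul_le_mul_of_nonneg_right (hpair z w) (sq_nonneg _))

/-! ### Differentiability from second differences -/

section DyadicQuotient

variable {E G : Type*} [NormedAddCommGroup E] [NormedSpace ℝ E] [NormedAddCommGroup G]
  [NormedSpace ℝ G]

/-- The difference quotient `2ⁿ g(2⁻ⁿ h)`; the derivative at `0` of a map `g` with `g 0 = 0` is
recovered as its limit, without any candidate for the derivative being known in advance. -/
noncomputable def dyadicQuotient (g : E → G) (h : E) (n : ℕ) : G :=
  (2 : ℝ) ^ n • g ((2⁻¹ : ℝ) ^ n • h)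

theorem dyadicQuotient_zero (g : E → G) (h : E) : dyadicQuotient g h 0 = g h := by
  simp [dyadicQuotient]

theorem dyadicQuotient_add (g : E → G) (h : E) (m n : ℕ) :
    dyadicQuotient g h (m + n) = (2 : ℝ) ^ n • dyadicQuotient g ((2⁻¹ : ℝ) ^ n • h) m := by
  simp only [dyadicQuotient, smul_smul, ← pow_add, add_comm]

theorem dyadicQuotient_succ (g : E → G) (h : E) (n : ℕ) : dyadicQuotient g h (n + 1) =
    dyadicQuotient g ((2⁻¹ : ℝ) • h) n + dyadicQuotient g ((2⁻¹ : ℝ) • h) n := by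
  rw [dyadicQuotient_add, pow_one, pow_one, two_smul]

theorem norm_two_inv_pow_smul (h : E) (n : ℕ) : ‖(2⁻¹ : ℝ) ^ n • h‖ = ‖h‖ / 2 ^ n := by
  rw [norm_smul, norm_pow, norm_inv, Real.norm_two, inv_pow, inv_mul_eq_div]

theorem eventually_norm_two_inv_pow_smul_le_one (h : E) :
    ∀ᶠ n : ℕ in atTop, ‖(2⁻¹ : ℝ) ^ n • h‖ ≤ 1 := by
  have hlim : Tendsto (fun n : ℕ => ‖h‖ / 2 ^ n) atTop (𝓝 0) :=
    tendsto_const_nhds.div_atTop (tendsto_pow_atTop_atTop_of_one_lt one_lt_two)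
  filter_upwards [hlim.eventually (eventually_le_nhds one_pos)] with n hn
  rwa [norm_two_inv_pow_smul]

theorem norm_dyadicQuotient_le {g : E → G} {C : ℝ} (hg : ∀ h : E, ‖h‖ ≤ 1 → ‖g h‖ ≤ C * ‖h‖)
    {h : E} {n : ℕ} (hn : ‖(2⁻¹ : ℝ) ^ n • h‖ ≤ 1) : ‖dyadicQuotient g h n‖ ≤ C * ‖h‖ := by
  rw [dyadicQuotient, norm_smul, norm_pow, Real.norm_two]
  calc 2 ^ n * ‖g ((2⁻¹ : ℝ) ^ n • h)‖ ≤ 2 ^ n * (C * (‖h‖ / 2 ^ n)) := by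
        rw [← norm_two_inv_pow_smul]
        gcongr
        exact hg _ hn
    _ = C * ‖h‖ := by field_simp

variable {g : E → G} {C : ℝ}

theorem norm_dyadicQuotient_add_sub_le
    (hg : ∀ h k : E, ‖h‖ ≤ 1 → ‖k‖ ≤ 1 → ‖g (h + k) - g h - g k‖ ≤ C * (‖h‖ + ‖k‖) ^ 2)
    {h k : E} {n : ℕ} (hh : ‖(2⁻¹ : ℝ) ^ n • h‖ ≤ 1) (hk : ‖(2⁻¹ : ℝ) ^ n • k‖ ≤ 1) :
    ‖dyadicQuotient g (h + k) n - dyadicQuotient g h n - dyadicQuotient g k n‖ ≤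
      C * (‖h‖ + ‖k‖) ^ 2 / 2 ^ n := by
  have hquad := hg _ _ hh hk
  rw [norm_two_inv_pow_smul, norm_two_inv_pow_smul] at hquad
  simp only [dyadicQuotient, ← smul_sub, smul_add]
  rw [norm_smul, norm_pow, Real.norm_two]
  refine (mul_le_mul_of_nonneg_left hquad (by positivity)).trans (le_of_eq ?_)
  field_simp

theorem dist_dyadicQuotient_succ_le
    (hg : ∀ h k : E, ‖h‖ ≤ 1 → ‖k‖ ≤ 1 → ‖g (h + k) - g h - g k‖ ≤ C * (‖h‖ + ‖k‖) ^ 2)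
    {h : E} (hh : ‖h‖ ≤ 1) (n : ℕ) :
    dist (dyadicQuotient g h n) (dyadicQuotient g h (n + 1)) ≤ 2 * C * ‖h‖ ^ 2 / 2 / 2 ^ n := by
  have hhalf : ‖(2⁻¹ : ℝ) • h‖ = ‖h‖ / 2 := by simpa using norm_two_inv_pow_smul h 1
  have hsmall : ‖(2⁻¹ : ℝ) ^ n • (2⁻¹ : ℝ) • h‖ ≤ 1 := by
    rw [norm_two_inv_pow_smul, hhalf]
    exact (div_le_self (by positivity) (one_le_pow₀ one_le_two)).trans
      ((half_le_self (norm_nonneg h)).trans hh)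
  have hsum : (2⁻¹ : ℝ) • h + (2⁻¹ : ℝ) • h = h := by rw [← add_smul]; norm_num
  have := norm_dyadicQuotient_add_sub_le hg hsmall hsmall
  rw [hsum, hhalf, add_halves, sub_sub, ← dyadicQuotient_succ, ← dist_eq_norm] at this
  exact this.trans (le_of_eq (by ring))

theorem norm_sub_le_of_tendsto_dyadicQuotient
    (hg : ∀ h k : E, ‖h‖ ≤ 1 → ‖k‖ ≤ 1 → ‖g (h + k) - g h - g k‖ ≤ C * (‖h‖ + ‖k‖) ^ 2)
    {h : E} (hh : ‖h‖ ≤ 1) {l : G} (hl : Tendsto (dyadicQuotient g h) atTop (𝓝 l)) :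
    ‖g h - l‖ ≤ 2 * C * ‖h‖ ^ 2 := by
  rw [← dist_eq_norm, ← dyadicQuotient_zero g h]
  exact dist_le_of_le_geometric_two_of_tendsto₀ (dist_dyadicQuotient_succ_le hg hh) hl

theorem exists_tendsto_dyadicQuotient [CompleteSpace G]
    (hg : ∀ h k : E, ‖h‖ ≤ 1 → ‖k‖ ≤ 1 → ‖g (h + k) - g h - g k‖ ≤ C * (‖h‖ + ‖k‖) ^ 2)
    (h : E) :
    ∃ l, Tendsto (dyadicQuotient g h) atTop (𝓝 l) := by
  obtain ⟨N, hN⟩ := (eventually_norm_two_inv_pow_smul_le_one h).exists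
  obtain ⟨l, hl⟩ := cauchySeq_tendsto_of_complete
    (cauchySeq_of_le_geometric_two (dist_dyadicQuotient_succ_le hg hN))
  refine ⟨(2 : ℝ) ^ N • l, (tendsto_add_atTop_iff_nat N).1 ?_⟩
  simpa only [dyadicQuotient_add] using hl.const_smul ((2 : ℝ) ^ N)

theorem exists_continuousLinearMap_tendsto_dyadicQuotient [CompleteSpace G]
    (hg : ∀ h k : E, ‖h‖ ≤ 1 → ‖k‖ ≤ 1 → ‖g (h + k) - g h - g k‖ ≤ C * (‖h‖ + ‖k‖) ^ 2)
    (hlip : ∀ h : E, ‖h‖ ≤ 1 → ‖g h‖ ≤ C * ‖h‖) :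
    ∃ L : E →L[ℝ] G, ∀ h, Tendsto (dyadicQuotient g h) atTop (𝓝 (L h)) := by
  choose L hL using exists_tendsto_dyadicQuotient hg
  have hadd : ∀ h k, L (h + k) = L h + L k := fun h k => by
    have hlim := ((hL (h + k)).sub (hL h)).sub (hL k)
    have hzero : Tendsto (fun n : ℕ => C * (‖h‖ + ‖k‖) ^ 2 / 2 ^ n) atTop (𝓝 0) :=
      tendsto_const_nhds.div_atTop (tendsto_pow_atTop_atTop_of_one_lt one_lt_two)
    have hsqueeze := squeeze_zero_norm' (by
      filter_upwards [eventually_norm_two_inv_pow_smul_le_one h,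
        eventually_norm_two_inv_pow_smul_le_one k] with n hn kn
      exact norm_dyadicQuotient_add_sub_le hg hn kn) hzero
    rw [← sub_eq_zero, ← sub_sub]
    exact tendsto_nhds_unique hlim hsqueeze
  have hbound : ∀ h, ‖L h‖ ≤ C * ‖h‖ := fun h => by
    refine le_of_tendsto (hL h).norm ?_
    filter_upwards [eventually_norm_two_inv_pow_smul_le_one h] with n hn
    exact norm_dyadicQuotient_le hlip hn
  let A : E →+ G := AddMonoidHom.mk' L hadd
  exact ⟨A.toRealLinearMap (AddMonoidHomClass.continuous_of_bound A C hbound), hL⟩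

end DyadicQuotient

theorem differentiableAt_of_norm_second_difference_le {E G : Type*} [NormedAddCommGroup E]
    [NormedSpace ℝ E] [NormedAddCommGroup G] [NormedSpace ℝ G] [CompleteSpace G]
    {F : E → G} {z : E} {C : ℝ}
    (hlip : ∀ h : E, ‖h‖ ≤ 1 → ‖F (z + h) - F z‖ ≤ C * ‖h‖)
    (hsec : ∀ h k : E, ‖h‖ ≤ 1 → ‖k‖ ≤ 1 →
      ‖F (z + h + k) - F (z + h) - F (z + k) + F z‖ ≤ C * (‖h‖ + ‖k‖) ^ 2) :
    DifferentiableAt ℝ F z := by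
  have hquad : ∀ h k : E, ‖h‖ ≤ 1 → ‖k‖ ≤ 1 →
      ‖(F (z + (h + k)) - F z) - (F (z + h) - F z) - (F (z + k) - F z)‖ ≤
        C * (‖h‖ + ‖k‖) ^ 2 := fun h k hh hk => by
    convert hsec h k hh hk using 2
    rw [← add_assoc]
    abel
  obtain ⟨L, hL⟩ := exists_continuousLinearMap_tendsto_dyadicQuotient
    (g := fun h => F (z + h) - F z) hquad hlip
  have hrem : (fun h => F (z + h) - F z - L h) =O[𝓝 0] fun h => ‖h‖ ^ 2 := by
    refine Asymptotics.IsBigO.of_bound (2 * C) ?_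
    filter_upwards [Metric.closedBall_mem_nhds (0 : E) one_pos] with h hh
    rw [norm_pow, norm_norm]
    exact norm_sub_le_of_tendsto_dyadicQuotient hquad (by simpa using hh) (hL h)
  refine HasFDerivAt.differentiableAt (f' := L) (hasFDerivAt_iff_isLittleO_nhds_zero.2 ?_)
  exact hrem.trans_isLittleO (Asymptotics.isLittleO_norm_pow_id one_lt_two)

/-! ### Local bounds from propagation -/

/-- The set of points near which a single bound holds, where `P M t` expresses that `M` is an
admissible bound at `t`. -/
def locallyBoundedSet {X : Type*} [TopologicalSpace X] (P : ℝ → X → Prop) : Set X :=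
  {t | ∃ M, ∀ᶠ s in 𝓝 t, P M s}

theorem isOpen_locallyBoundedSet {X : Type*} [TopologicalSpace X] (P : ℝ → X → Prop) :
    IsOpen (locallyBoundedSet P) := by
  simp only [locallyBoundedSet, ofPred_exists]
  exact isOpen_iUnion fun M => isOpen_setOfPred_eventually_nhds

theorem exists_bound_of_isCompact {X : Type*} [TopologicalSpace X] {P : ℝ → X → Prop}
    (hmono : ∀ ⦃M M' t⦄, M ≤ M' → P M t → P M' t) {S : Set X} (hS : IsCompact S)
    (hSP : S ⊆ locallyBoundedSet P) : ∃ M, ∀ t ∈ S, P M t := by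
  refine hS.induction_on (p := fun S => ∃ M, ∀ t ∈ S, P M t) ⟨0, by simp⟩ ?_ ?_ ?_
  · rintro s t hst ⟨M, hM⟩
    exact ⟨M, fun r hr => hM r (hst hr)⟩
  · rintro s t ⟨M, hM⟩ ⟨M', hM'⟩
    exact ⟨max M M', fun r hr => hr.elim (fun hr => hmono (le_max_left _ _) (hM r hr))
      fun hr => hmono (le_max_right _ _) (hM' r hr)⟩
  · intro t ht
    obtain ⟨M, hM⟩ := hSP ht
    exact ⟨_, mem_nhdsWithin_of_mem_nhds hM, M, fun s hs => hs⟩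

theorem exists_bound_on_ball_inter {X : Type*} [MetricSpace X] [CompleteSpace X]
    {P : ℝ → X → Prop} (hmono : ∀ ⦃M M' t⦄, M ≤ M' → P M t → P M' t)
    (hclosed : ∀ M, IsClosed {t | P M t}) (hex : ∀ t, ∃ M, P M t) {F : Set X} (hF : IsClosed F)
    (hne : F.Nonempty) : ∃ t₀ ∈ F, ∃ ε > 0, ∃ N, ∀ t ∈ F, dist t t₀ < ε → P N t := by
  have : Nonempty F := hne.to_subtype
  have : CompleteSpace F := hF.completeSpace_coe
  obtain ⟨N, t₀, ht₀⟩ := nonempty_interior_of_iUnion_of_closed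
    (f := fun n : ℕ => {t : F | P n t})
    (fun n => (hclosed n).preimage continuous_subtype_val) (by
      refine eq_univ_of_forall fun t => mem_iUnion.2 ?_
      obtain ⟨M, hM⟩ := hex t
      obtain ⟨n, hn⟩ := exists_nat_ge M
      exact ⟨n, hmono hn hM⟩)
  obtain ⟨ε, hε, hball⟩ := Metric.mem_nhds_iff.1 (mem_interior_iff_mem_nhds.1 ht₀)
  exact ⟨t₀, t₀.2, ε, hε, N, fun t ht htd => hball (a := ⟨t, ht⟩) htd⟩

theorem exists_nearest_mem_uIcc {F : Set ℝ} (hF : IsClosed F) {s : ℝ} (hs : s ∈ F) (t : ℝ) :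
    ∃ a ∈ F, a ∈ uIcc s t ∧ ∀ r ∈ uIcc a t, r ≠ a → r ∉ F := by
  obtain ⟨a, ⟨hau, haF⟩, hmin⟩ := (isCompact_uIcc.inter_right hF).exists_isMinOn
    ⟨s, left_mem_uIcc, hs⟩ (continuous_id.dist (continuous_const (y := t))).continuousOn
  refine ⟨a, haF, hau, fun r hr hra hrF => hra ?_⟩
  have hle : dist a t ≤ dist r t := hmin ⟨uIcc_subset_uIcc_right hau hr, hrF⟩
  have hadd := dist_add_dist_of_mem_segment (segment_eq_uIcc a t ▸ hr)
  exact (dist_le_zero.1 (by linarith)).symm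

section Propagation

variable {P : ℝ → ℝ → Prop} {f : ℝ → ℝ → ℝ}

theorem bound_of_uIcc_diff_subset (hmono : ∀ ⦃M M' t⦄, M ≤ M' → P M t → P M' t)
    (hex : ∀ t, ∃ M, P M t) (hf : ∀ m, MonotoneOn (f m) (Ici 0))
    (hprop : ∀ s t M m, (∀ r ∈ uIcc s t, P M r) → P m s → P (f m |t - s|) t) {a t N : ℝ}
    (ha : P N a) (hat : ∀ r ∈ uIcc a t, r ≠ a → r ∈ locallyBoundedSet P) :
    P (f N |t - a|) t := by
  obtain ⟨m, hm⟩ := hex t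
  refine hprop a t (max N (f m |a - t|)) N (fun s hs => ?_) ha
  rcases eq_or_ne s a with rfl | hsa
  · exact hmono (le_max_left _ _) ha
  have hsub : uIcc t s ⊆ locallyBoundedSet P := fun r hr => by
    refine hat r (uIcc_subset_uIcc right_mem_uIcc hs hr) ?_
    rintro rfl
    have h₁ := dist_add_dist_of_mem_segment (segment_eq_uIcc r t ▸ hs)
    have h₂ := dist_add_dist_of_mem_segment (segment_eq_uIcc t s ▸ hr)
    rw [dist_comm r t, dist_comm s t, dist_comm r s] at *
    exact hsa (dist_le_zero.1 (by linarith))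
  obtain ⟨M, hM⟩ := exists_bound_of_isCompact hmono isCompact_uIcc hsub
  refine hmono (le_trans ?_ (le_max_right _ _)) (hprop t s M m hM hm)
  rw [uIcc_comm] at hs
  exact hf m (mem_Ici.2 (abs_nonneg _)) (mem_Ici.2 (abs_nonneg _)) (abs_sub_left_of_mem_uIcc hs)

/-- By Baire's theorem a single bound holds on a relatively open part of the set of bad times,
those with no locally uniform bound. Propagation from this part across the adjacent intervals of
good times gives a bound near a bad time, so that there are none. -/
theorem exists_bound_Icc_of_propagation (hmono : ∀ ⦃M M' t⦄, M ≤ M' → P M t → P M' t)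
    (hclosed : ∀ M, IsClosed {t | P M t}) (hex : ∀ t, ∃ M, P M t)
    (hf : ∀ m, MonotoneOn (f m) (Ici 0))
    (hprop : ∀ s t M m, (∀ r ∈ uIcc s t, P M r) → P m s → P (f m |t - s|) t) (T : ℝ) :
    ∃ M, ∀ t ∈ Icc (-T) T, P M t := by
  refine exists_bound_of_isCompact hmono isCompact_Icc fun t _ => ?_
  by_contra htbad
  have hbad : IsClosed (locallyBoundedSet P)ᶜ := (isOpen_locallyBoundedSet P).isClosed_compl
  obtain ⟨t₀, ht₀, ε, hε, N, hN⟩ := exists_bound_on_ball_inter hmono hclosed hex hbad ⟨t, htbad⟩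
  refine ht₀ ⟨max N (f N ε), ?_⟩
  filter_upwards [Metric.ball_mem_nhds t₀ hε] with t ht
  rw [Metric.mem_ball, Real.dist_eq] at ht
  obtain ⟨a, habad, hau, hagood⟩ := exists_nearest_mem_uIcc hbad ht₀ t
  have hat₀ : |a - t₀| ≤ |t - t₀| := abs_sub_left_of_mem_uIcc hau
  have hta : |t - a| ≤ |t - t₀| := abs_sub_right_of_mem_uIcc hau
  have ha : P N a := hN a habad (hat₀.trans_lt ht)
  have hfN : f N |t - a| ≤ f N ε :=
    hf N (mem_Ici.2 (abs_nonneg _)) (mem_Ici.2 hε.le) (hta.trans ht.le)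
  exact hmono (hfN.trans (le_max_right _ _))
    (bound_of_uIcc_diff_subset hmono hex hf hprop ha fun r hr hra =>
      not_not.1 (hagood r hr hra))

end Propagation

variable {d : ℕ}

/-! ### The lattice -/

/-- The weight `e + |j|` of a site. -/
noncomputable def siteWeight (j : Site d) : ℝ := Real.exp 1 + (siteDist j 0 : ℝ)

theorem siteDist_nonneg (i j : Site d) : 0 ≤ siteDist i j :=
  Finset.sum_nonneg fun _ _ => abs_nonneg _

theorem exp_one_le_siteWeight (j : Site d) : Real.exp 1 ≤ siteWeight j := by
  have : (0 : ℝ) ≤ siteDist j 0 := by exact_mod_cast siteDist_nonneg j 0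
  unfold siteWeight
  linarith

theorem two_le_siteWeight (j : Site d) : 2 ≤ siteWeight j := by
  have := exp_one_le_siteWeight j
  have := Real.add_one_le_exp 1
  linarith

theorem siteWeight_pos (j : Site d) : 0 < siteWeight j :=
  (Real.exp_pos 1).trans_le (exp_one_le_siteWeight j)

theorem one_le_log_siteWeight (j : Site d) : 1 ≤ Real.log (siteWeight j) := by
  rw [Real.le_log_iff_exp_le (siteWeight_pos j)]
  exact exp_one_le_siteWeight j

theorem log_siteWeight_le (j : Site d) : Real.log (siteWeight j) ≤ siteWeight j := by
  have := Real.log_le_sub_one_of_pos (siteWeight_pos j)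
  linarith

theorem siteDist_triangle (i j k : Site d) : siteDist i k ≤ siteDist i j + siteDist j k := by
  unfold siteDist
  rw [← Finset.sum_add_distrib]
  exact Finset.sum_le_sum fun l _ => abs_sub_le _ _ _

theorem siteWeight_le_of_mem_nbrs {j k : Site d} (hk : k ∈ nbrs j) :
    siteWeight k ≤ siteWeight j + 1 := by
  have hdist := siteDist_triangle k j 0
  rw [mem_nbrs.1 hk] at hdist
  have : (siteDist k 0 : ℝ) ≤ 1 + siteDist j 0 := by exact_mod_cast hdist
  unfold siteWeight
  linarith

theorem card_cube (ν : Site d) (k : ℕ) : (cube ν k).card = (2 * k + 1) ^ d := by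
  have hside : ∀ l : Fin d, (ν l + (k : ℤ) + 1 - (ν l - (k : ℤ))).toNat = 2 * k + 1 := by omega
  simp [cube, Pi.card_Icc, hside]

theorem card_filter_siteDist_le (S : Finset (Site d)) (i : Site d) :
    (S.filter fun j => siteDist j i = 1).card ≤ 3 ^ d := by
  have hsub : (S.filter fun j => siteDist j i = 1) ⊆ cube i 1 := fun j hj =>
    Finset.filter_subset _ _ (mem_nbrs.2 (Finset.mem_filter.1 hj).2)
  exact (Finset.card_le_card hsub).trans_eq (card_cube i 1)

theorem card_nbrs_le (i : Site d) : (nbrs i).card ≤ 3 ^ d :=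
  card_filter_siteDist_le _ i

theorem sum_sum_filter_comm (S : Finset (Site d)) (g : Site d → Site d → ℝ) :
    ∑ i ∈ S, ∑ j ∈ S.filter (fun j => siteDist j i = 1), g i j =
      ∑ i ∈ S, ∑ j ∈ S.filter (fun j => siteDist j i = 1), g j i := by
  refine Finset.sum_comm' fun i j => ?_
  simp only [Finset.mem_filter, siteDist_comm i j]
  tauto

theorem sum_sum_filter_left_le (S : Finset (Site d)) {a : Site d → ℝ} (ha : ∀ i, 0 ≤ a i) :
    ∑ i ∈ S, ∑ _j ∈ S.filter (fun j => siteDist j i = 1), a i ≤ 3 ^ d * ∑ i ∈ S, a i := by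
  rw [Finset.mul_sum]
  refine Finset.sum_le_sum fun i _ => ?_
  rw [Finset.sum_const, nsmul_eq_mul]
  exact mul_le_mul_of_nonneg_right (mod_cast card_filter_siteDist_le S i) (ha i)

theorem sum_sum_filter_right_le (S : Finset (Site d)) {a : Site d → ℝ} (ha : ∀ i, 0 ≤ a i) :
    ∑ i ∈ S, ∑ j ∈ S.filter (fun j => siteDist j i = 1), a j ≤ 3 ^ d * ∑ i ∈ S, a i := by
  rw [sum_sum_filter_comm S fun _ j => a j]
  exact sum_sum_filter_left_le S ha

/-! ### Energy bounds -/

/-- The cubes of center `ν` and side `2k+1`, with `k > log^{1/d}(e+|ν|)`, have energy at most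
`M (2k+1)^d`, the interaction not being taken into account. -/
def EnergyBound (U : ℝ[X]) (M : ℝ) (x : Config d) : Prop :=
  ∀ (ν : Site d) (k : ℕ), Real.log (siteWeight ν) ^ (1 / (d : ℝ)) < (k : ℝ) →
    ∑ i ∈ cube ν k, siteEnergy U (x i) ≤ M * (2 * (k : ℝ) + 1) ^ d

section EnergyBounds

variable {K c M : ℝ} {U : ℝ[X]} {x : Config d}

theorem EnergyBound.mono {M' : ℝ} (h : EnergyBound U M x) (hM : M ≤ M') : EnergyBound U M' x :=
  fun ν k hk => (h ν k hk).trans (by gcongr)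

theorem one_le_of_log_siteWeight_rpow_lt {ν : Site d} {k : ℕ}
    (hk : Real.log (siteWeight ν) ^ (1 / (d : ℝ)) < (k : ℝ)) : 1 ≤ k := by
  have : (0 : ℝ) ≤ Real.log (siteWeight ν) ^ (1 / (d : ℝ)) :=
    Real.rpow_nonneg (zero_le_one.trans (one_le_log_siteWeight ν)) _
  have : (0 : ℝ) < k := this.trans_lt hk
  exact_mod_cast this

theorem exists_cube_radius (hd : 1 ≤ d) (ν : Site d) :
    ∃ k : ℕ, Real.log (siteWeight ν) ^ (1 / (d : ℝ)) < (k : ℝ) ∧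
      (2 * (k : ℝ) + 1) ^ d ≤ 5 ^ d * Real.log (siteWeight ν) := by
  set L := Real.log (siteWeight ν)
  have hL : 1 ≤ L := one_le_log_siteWeight ν
  set r := L ^ (1 / (d : ℝ))
  have hr : 1 ≤ r := Real.one_le_rpow hL (by positivity)
  have hrd : r ^ d = L := by
    simp only [r, one_div]
    exact Real.rpow_inv_natCast_pow (by linarith) (by omega)
  refine ⟨⌊r⌋₊ + 1, by push_cast; exact Nat.lt_floor_add_one r, ?_⟩
  rw [← hrd, ← mul_pow]
  have : (⌊r⌋₊ : ℝ) ≤ r := Nat.floor_le (by linarith)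
  gcongr
  push_cast
  linarith

theorem EnergyBound.siteEnergy_le (hc : GrowthBounds U c) (hd : 1 ≤ d)
    (h : EnergyBound U M x) (j : Site d) :
    siteEnergy U (x j) ≤ 5 ^ d * M * Real.log (siteWeight j) := by
  obtain ⟨k, hk, hk'⟩ := exists_cube_radius hd j
  have hpos : ∀ i ∈ cube j k, 0 ≤ siteEnergy U (x i) := fun i _ => hc.siteEnergy_nonneg _
  have hsingle : siteEnergy U (x j) ≤ ∑ i ∈ cube j k, siteEnergy U (x i) :=
    Finset.single_le_sum (f := fun i => siteEnergy U (x i)) hpos (mem_cube.2 (by simp))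
  have hM : 0 ≤ M := by
    have : 0 ≤ M * (2 * (k : ℝ) + 1) ^ d := (Finset.sum_nonneg hpos).trans (h j k hk)
    exact nonneg_of_mul_nonneg_left this (by positivity)
  calc siteEnergy U (x j) ≤ M * (2 * (k : ℝ) + 1) ^ d := hsingle.trans (h j k hk)
    _ ≤ M * (5 ^ d * Real.log (siteWeight j)) := by gcongr
    _ = _ := by ring

theorem EnergyBound.one_le (hc : GrowthBounds U c) (hd : 1 ≤ d) (h : EnergyBound U M x) :
    1 ≤ M := by
  obtain ⟨k, hk, -⟩ := exists_cube_radius hd 0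
  have hcard : (2 * (k : ℝ) + 1) ^ d ≤ ∑ i ∈ cube 0 k, siteEnergy U (x i) := by
    have : ((cube (0 : Site d) k).card : ℝ) ≤ ∑ i ∈ cube 0 k, siteEnergy U (x i) := by
      rw [Finset.cast_card]
      exact Finset.sum_le_sum fun i _ => hc.one_le_siteEnergy _
    rwa [card_cube, Nat.cast_pow, Nat.cast_succ, Nat.cast_mul, Nat.cast_two] at this
  exact le_of_mul_le_mul_right ((one_mul _).trans_le (hcard.trans (h 0 k hk))) (by positivity)

theorem EnergyBound.update (hc : GrowthBounds U c) (h : EnergyBound U M x) (i : Site d)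
    (z : ℝ × ℝ) : EnergyBound U (M + siteEnergy U z) (Function.update x i z) := by
  classical
  intro ν k hk
  have hz : 0 ≤ siteEnergy U z := hc.siteEnergy_nonneg z
  have hsite : ∀ j, siteEnergy U (Function.update x i z j) ≤
      siteEnergy U (x j) + if j = i then siteEnergy U z else 0 := fun j => by
    rcases eq_or_ne j i with rfl | hj
    · simpa using hc.siteEnergy_nonneg (x j)
    · simp [hj]
  have hvol : (1 : ℝ) ≤ (2 * (k : ℝ) + 1) ^ d :=
    one_le_pow₀ (le_add_of_nonneg_left (by positivity))
  calc ∑ j ∈ cube ν k, siteEnergy U (Function.update x i z j)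
      ≤ ∑ j ∈ cube ν k, siteEnergy U (x j) + if i ∈ cube ν k then siteEnergy U z else 0 := by
        rw [← Finset.sum_ite_eq' (cube ν k) i fun _ => siteEnergy U z, ← Finset.sum_add_distrib]
        exact Finset.sum_le_sum fun j _ => hsite j
    _ ≤ M * (2 * (k : ℝ) + 1) ^ d + siteEnergy U z * (2 * (k : ℝ) + 1) ^ d := by
        gcongr
        · exact h ν k hk
        · split_ifs
          · exact le_mul_of_one_le_right hz hvol
          · positivity
    _ = (M + siteEnergy U z) * (2 * (k : ℝ) + 1) ^ d := (add_mul _ _ _).symm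

theorem EnergyBound.of_tendsto {ι : Type*} {l : Filter ι} [NeBot l]
    {x : ι → Config d} {y : Config d} (hx : ∀ j, Tendsto (fun n => x n j) l (𝓝 (y j)))
    (h : ∀ᶠ n in l, EnergyBound U M (x n)) : EnergyBound U M y := fun ν k hk => by
  have ht : Tendsto (fun n => ∑ i ∈ cube ν k, siteEnergy U (x n i)) l
      (𝓝 (∑ i ∈ cube ν k, siteEnergy U (y i))) :=
    tendsto_finsetSum _ fun i _ => ((continuous_siteEnergy U).tendsto _).comp (hx i)
  exact le_of_tendsto ht (h.mono fun n hn => hn ν k hk)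

theorem sum_siteEnergy_le_localEnergy (hK : 0 ≤ K) (U : ℝ[X]) (ν : Site d) (k : ℕ)
    (x : Config d) : ∑ i ∈ cube ν k, siteEnergy U (x i) ≤ localEnergy K U ν k x := by
  unfold localEnergy siteEnergy
  have : 0 ≤ ∑ i ∈ cube ν k, ∑ j ∈ (cube ν k).filter (fun j => siteDist j i = 1),
      K / 4 * ((x i).1 - (x j).1) ^ 2 := by positivity
  linarith

theorem sum_mul_bond_le (hK : 0 ≤ K) (hc : GrowthBounds U c) (S : Finset (Site d))
    (x : Config d) {f : Site d → ℝ} (hf : ∀ i, 0 ≤ f i)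
    (hff : ∀ i j, siteDist j i = 1 → f i ≤ 2 * f j) :
    ∑ i ∈ S, ∑ j ∈ S.filter (fun j => siteDist j i = 1), f i * (K / 4 * ((x i).1 - (x j).1) ^ 2) ≤
      2 * K * c * 3 ^ d * ∑ i ∈ S, f i * siteEnergy U (x i) := by
  have hKc : 0 ≤ K * c := mul_nonneg hK (zero_le_one.trans hc.one_le)
  have hpos : ∀ i, 0 ≤ K * c * (f i * siteEnergy U (x i)) := fun i =>
    mul_nonneg hKc (mul_nonneg (hf i) (hc.siteEnergy_nonneg _))
  have hbond : ∀ i j, siteDist j i = 1 → f i * (K / 4 * ((x i).1 - (x j).1) ^ 2) ≤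
      K * c * (f i * siteEnergy U (x i)) + K * c * (f j * siteEnergy U (x j)) := fun i j hij => by
    have hsq : f i * (K / 4 * ((x i).1 - (x j).1) ^ 2) ≤
        f i * (K / 4 * (2 * c * (siteEnergy U (x i) + siteEnergy U (x j)))) := by
      have := hf i
      have := hc.sq_sub_le (x i) (x j)
      gcongr
    have hshift : K * c * (f i * siteEnergy U (x j)) ≤
        K * c * (2 * f j * siteEnergy U (x j)) := by
      have := hc.siteEnergy_nonneg (x j)
      have := hff i j hij
      gcongr
    linarith [hpos i]
  calc _ ≤ ∑ i ∈ S, ∑ j ∈ S.filter (fun j => siteDist j i = 1),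
        (K * c * (f i * siteEnergy U (x i)) + K * c * (f j * siteEnergy U (x j))) :=
        Finset.sum_le_sum fun i _ => Finset.sum_le_sum fun j hj =>
          hbond i j (Finset.mem_filter.1 hj).2
    _ ≤ 3 ^ d * ∑ i ∈ S, K * c * (f i * siteEnergy U (x i)) +
        3 ^ d * ∑ i ∈ S, K * c * (f i * siteEnergy U (x i)) := by
        simp only [Finset.sum_add_distrib]
        exact add_le_add (sum_sum_filter_left_le S hpos) (sum_sum_filter_right_le S hpos)
    _ = 2 * K * c * 3 ^ d * ∑ i ∈ S, f i * siteEnergy U (x i) := by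
        rw [← Finset.mul_sum]
        ring

theorem localEnergy_le (hK : 0 ≤ K) (hc : GrowthBounds U c) (ν : Site d) (k : ℕ) (x : Config d) :
    localEnergy K U ν k x ≤ (1 + 2 * K * c * 3 ^ d) * ∑ i ∈ cube ν k, siteEnergy U (x i) := by
  have hbond := sum_mul_bond_le hK hc (cube ν k) x (f := fun _ => 1) (fun _ => zero_le_one)
    (fun _ _ _ => one_le_two.trans_eq (mul_one 2).symm)
  simp only [one_mul] at hbond
  rw [add_mul, one_mul]
  exact add_le_add le_rfl hbond

theorem Q_ne_bot (hd : 1 ≤ d) (x : Config d) : Q K U x ≠ ⊥ := by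
  obtain ⟨k, hk, -⟩ := exists_cube_radius hd 0
  exact ne_bot_of_le_ne_bot (EReal.coe_ne_bot _)
    (le_iSup_of_le (0 : Site d) (le_iSup_of_le k (le_iSup_of_le hk le_rfl)))

theorem energyBound_toReal_Q (hK : 0 ≤ K) (hd : 1 ≤ d) (hx : x ∈ X₀ d K U) :
    EnergyBound U (Q K U x).toReal x := by
  intro ν k hk
  have h : ((localEnergy K U ν k x / (2 * (k : ℝ) + 1) ^ d : ℝ) : EReal) ≤ Q K U x :=
    le_iSup_of_le ν (le_iSup_of_le k (le_iSup_of_le hk le_rfl))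
  rw [← EReal.coe_toReal (ne_of_lt hx) (Q_ne_bot hd x), EReal.coe_le_coe_iff,
    div_le_iff₀ (by positivity)] at h
  exact (sum_siteEnergy_le_localEnergy hK U ν k x).trans h

theorem EnergyBound.Q_le (hK : 0 ≤ K) (hc : GrowthBounds U c) (h : EnergyBound U M x) :
    Q K U x ≤ (((1 + 2 * K * c * 3 ^ d) * M : ℝ) : EReal) := by
  refine iSup_le fun ν => iSup_le fun k => iSup_le fun hk => ?_
  rw [EReal.coe_le_coe_iff, div_le_iff₀ (by positivity), mul_assoc]
  have := hc.one_le
  refine (localEnergy_le hK hc ν k x).trans ?_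
  gcongr
  exact h ν k hk

theorem EnergyBound.mem_X₀ (hK : 0 ≤ K) (hc : GrowthBounds U c) (h : EnergyBound U M x) :
    x ∈ X₀ d K U :=
  (h.Q_le hK hc).trans_lt (EReal.coe_lt_top _)

end EnergyBounds

/-! ### Grönwall inequalities -/

theorem exists_unit_speed_path (s t : ℝ) : ∃ σ : ℝ, |σ| = 1 ∧ s + σ * |t - s| = t ∧
    ∀ r ∈ Icc 0 |t - s|, s + σ * r ∈ uIcc s t := by
  rcases le_total s t with hst | hts
  · refine ⟨1, abs_one, by rw [abs_of_nonneg (sub_nonneg.2 hst)]; ring, fun r hr => ?_⟩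
    rw [abs_of_nonneg (sub_nonneg.2 hst)] at hr
    exact mem_uIcc_of_le (by linarith [hr.1]) (by linarith [hr.2])
  · refine ⟨-1, by simp, by rw [abs_of_nonpos (sub_nonpos.2 hts)]; ring, fun r hr => ?_⟩
    rw [abs_of_nonpos (sub_nonpos.2 hts)] at hr
    exact mem_uIcc_of_ge (by linarith [hr.2]) (by linarith [hr.1])

theorem hasDerivAt_comp_add_mul {E : Type*} [NormedAddCommGroup E] [NormedSpace ℝ E] {w : ℝ → E}
    {w' : E} {s σ r : ℝ} (hw : HasDerivAt w w' (s + σ * r)) :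
    HasDerivAt (fun r => w (s + σ * r)) (σ • w') r := by
  have hpath : HasDerivAt (fun r => s + σ * r) σ r := by
    simpa using ((hasDerivAt_id r).const_mul σ).const_add s
  exact hw.scomp r hpath

theorem norm_le_exp_mul_of_norm_deriv_le {E : Type*} [NormedAddCommGroup E] [NormedSpace ℝ E]
    {w w' : ℝ → E} {k s t : ℝ} (hw : ∀ r ∈ uIcc s t, HasDerivAt w (w' r) r)
    (hw' : ∀ r ∈ uIcc s t, ‖w' r‖ ≤ k * ‖w r‖) : ‖w t‖ ≤ Real.exp (k * |t - s|) * ‖w s‖ := by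
  obtain ⟨σ, hσ, hend, hpath⟩ := exists_unit_speed_path s t
  have hgronwall := norm_le_gronwallBound_of_norm_deriv_right_le
    (f := fun r => w (s + σ * r)) (δ := ‖w s‖) (K := k) (ε := 0) (a := 0) (b := |t - s|)
    (fun r hr => (hasDerivAt_comp_add_mul (hw _ (hpath r hr))).continuousAt.continuousWithinAt)
    (fun r hr => (hasDerivAt_comp_add_mul
      (hw _ (hpath r (Ico_subset_Icc_self hr)))).hasDerivWithinAt)
    (by simp) (fun r hr => by
      rw [norm_smul, Real.norm_eq_abs, hσ, one_mul, add_zero]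
      exact hw' _ (hpath r (Ico_subset_Icc_self hr)))
    |t - s| (right_mem_Icc.2 (abs_nonneg _))
  rwa [gronwallBound_ε0, sub_zero, hend, mul_comm] at hgronwall

theorem norm_le_two_mul_of_norm_deriv_le_half {ι E : Type*} [NormedAddCommGroup E]
    [NormedSpace ℝ E] {T b M : ℝ} {w w' : ℝ → ι → E} {φ φ' : ι → ℝ → ℝ} (hb : 0 ≤ b)
    (hM : 0 ≤ M) (hφ : ∀ j t, 0 ≤ φ j t) (hφ' : ∀ j t, HasDerivAt (φ j) (φ' j t) t)
    (hw : ∀ t ∈ Icc 0 T, ∀ j, HasDerivAt (fun s => w s j) (w' t j) t)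
    (hstart : ∀ j, ‖w 0 j‖ ≤ b * φ j 0)
    (hderiv : ∀ t ∈ Icc 0 T, ∀ m, 0 ≤ m → (∀ j, ‖w t j‖ ≤ m * φ j t) →
      ∀ j, ‖w' t j‖ ≤ (b + m / 2) * φ' j t)
    (hprior : ∀ t ∈ Icc 0 T, ∀ j, ‖w t j‖ ≤ M * φ j t) :
    ∀ t ∈ Icc 0 T, ∀ j, ‖w t j‖ ≤ 2 * b * φ j t := by
  have himprove : ∀ m : ℝ, 0 ≤ m → (∀ t ∈ Icc 0 T, ∀ j, ‖w t j‖ ≤ m * φ j t) →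
      ∀ t ∈ Icc 0 T, ∀ j, ‖w t j‖ ≤ (b + m / 2) * φ j t := fun m hm hwm t ht j =>
    image_norm_le_of_norm_deriv_right_le_deriv_boundary (a := 0) (b := T)
      (f := fun s => w s j) (f' := fun s => w' s j) (B := fun s => (b + m / 2) * φ j s)
      (fun s hs => (hw s hs j).continuousAt.continuousWithinAt)
      (fun s hs => (hw s (Ico_subset_Icc_self hs) j).hasDerivWithinAt)
      ((hstart j).trans (mul_le_mul_of_nonneg_right (by linarith) (hφ j 0)))
      (fun s => (hφ' j s).const_mul _)
      (fun s hs => hderiv s (Ico_subset_Icc_self hs) m hm (hwm s (Ico_subset_Icc_self hs)) j) ht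
  have hiter : ∀ n : ℕ, ∀ t ∈ Icc 0 T, ∀ j, ‖w t j‖ ≤ (2 * b + M / 2 ^ n) * φ j t := by
    intro n
    induction n with
    | zero =>
      refine fun t ht j => (hprior t ht j).trans (mul_le_mul_of_nonneg_right ?_ (hφ j t))
      rw [pow_zero, div_one]
      linarith
    | succ n ih =>
      intro t ht j
      convert himprove _ (by positivity) ih t ht j using 2
      rw [pow_succ]
      ring
  intro t ht j
  have hlim : Tendsto (fun n : ℕ => (2 * b + M / 2 ^ n) * φ j t) atTop
      (𝓝 ((2 * b + 0) * φ j t)) :=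
    (tendsto_const_nhds.add (tendsto_const_nhds.div_atTop
      (tendsto_pow_atTop_atTop_of_one_lt one_lt_two))).mul_const _
  rw [add_zero] at hlim
  exact ge_of_tendsto' hlim fun n => hiter n t ht j

/-- The polynomial weight `(e + |j| + κ) ^ (a + lam t)`, used to absorb the logarithmically growing
constants in a Grönwall inequality: its logarithmic derivative is `lam log (e + |j| + κ)`. The shift
`κ` keeps the ratio of the weights at neighboring sites bounded as long as `a + lam t ≤ κ`. -/
noncomputable def gronwallWeight (a lam κ : ℝ) (j : Site d) (t : ℝ) : ℝ :=
  Real.exp ((a + lam * t) * Real.log (siteWeight j + κ))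

section GronwallWeight

variable {a lam κ t : ℝ} {α : ℕ}

theorem gronwallWeight_nonneg (a lam κ : ℝ) (j : Site d) (t : ℝ) :
    0 ≤ gronwallWeight a lam κ j t :=
  (Real.exp_pos _).le

theorem hasDerivAt_gronwallWeight (a lam κ : ℝ) (j : Site d) (t : ℝ) :
    HasDerivAt (gronwallWeight a lam κ j)
      (lam * Real.log (siteWeight j + κ) * gronwallWeight a lam κ j t) t := by
  have h : HasDerivAt (fun s : ℝ => (a + lam * s) * Real.log (siteWeight j + κ))
      (lam * 1 * Real.log (siteWeight j + κ)) t :=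
    (((hasDerivAt_id t).const_mul lam).const_add _).mul_const _
  exact h.exp.congr_deriv (by rw [gronwallWeight]; ring)

theorem log_siteWeight_le_log_add (hκ : 0 ≤ κ) (j : Site d) :
    Real.log (siteWeight j) ≤ Real.log (siteWeight j + κ) :=
  Real.log_le_log (siteWeight_pos j) (le_add_of_nonneg_right hκ)

theorem one_le_log_siteWeight_add (hκ : 0 ≤ κ) (j : Site d) :
    1 ≤ Real.log (siteWeight j + κ) :=
  (one_le_log_siteWeight j).trans (log_siteWeight_le_log_add hκ j)

theorem exp_mul_log_siteWeight_add (hκ : 0 ≤ κ) (j : Site d) (n : ℕ) :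
    Real.exp (n * Real.log (siteWeight j + κ)) = (siteWeight j + κ) ^ n := by
  rw [Real.exp_nat_mul, Real.exp_log (add_pos_of_pos_of_nonneg (siteWeight_pos j) hκ)]

theorem siteWeight_pow_le_gronwallWeight (hκ : 0 ≤ κ) (ht : 0 ≤ lam * t) (j : Site d) :
    siteWeight j ^ α ≤ gronwallWeight α lam κ j t :=
  calc siteWeight j ^ α ≤ (siteWeight j + κ) ^ α :=
        pow_le_pow_left₀ (siteWeight_pos j).le (le_add_of_nonneg_right hκ) α
    _ = Real.exp (α * Real.log (siteWeight j + κ)) := (exp_mul_log_siteWeight_add hκ j α).symm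
    _ ≤ gronwallWeight α lam κ j t := by
        have := one_le_log_siteWeight_add hκ j
        unfold gronwallWeight
        gcongr
        exact le_add_of_nonneg_right ht

theorem gronwallWeight_le (hκ : 0 ≤ κ) (ht : a + lam * t ≤ κ) (j : Site d) :
    gronwallWeight a lam κ j t ≤ ((1 + κ) * siteWeight j) ^ ⌈κ⌉₊ :=
  calc gronwallWeight a lam κ j t ≤ Real.exp (⌈κ⌉₊ * Real.log (siteWeight j + κ)) := by
        have := one_le_log_siteWeight_add hκ j
        have := ht.trans (Nat.le_ceil κ)
        unfold gronwallWeight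
        gcongr
    _ = (siteWeight j + κ) ^ ⌈κ⌉₊ := exp_mul_log_siteWeight_add hκ j _
    _ ≤ ((1 + κ) * siteWeight j) ^ ⌈κ⌉₊ := by
        have := two_le_siteWeight j
        gcongr
        nlinarith

theorem gronwallWeight_le_of_mem_nbrs (hκ : 0 ≤ κ) (ht₀ : 0 ≤ a + lam * t)
    (ht : a + lam * t ≤ κ) {j k : Site d} (hk : k ∈ nbrs j) :
    gronwallWeight a lam κ k t ≤ Real.exp 1 * gronwallWeight a lam κ j t := by
  have hj : 0 < siteWeight j + κ := add_pos_of_pos_of_nonneg (siteWeight_pos j) hκ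
  have hk' : 0 < siteWeight k + κ := add_pos_of_pos_of_nonneg (siteWeight_pos k) hκ
  have hlog : Real.log (siteWeight k + κ) - Real.log (siteWeight j + κ) ≤
      1 / (siteWeight j + κ) := by
    rw [← Real.log_div hk'.ne' hj.ne']
    refine (Real.log_le_sub_one_of_pos (div_pos hk' hj)).trans ?_
    rw [div_sub_one hj.ne']
    have := siteWeight_le_of_mem_nbrs hk
    gcongr
    linarith
  have hexponent : (a + lam * t) * (1 / (siteWeight j + κ)) ≤ 1 := by
    rw [mul_one_div, div_le_one hj]
    linarith [siteWeight_pos j]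
  unfold gronwallWeight
  rw [← Real.exp_add, Real.exp_le_exp]
  linarith [mul_le_mul_of_nonneg_left hlog ht₀]

theorem add_sum_nbrs_le_gronwallWeight (hκ : 0 ≤ κ) (ht₀ : 0 ≤ a + lam * t)
    (ht : a + lam * t ≤ κ) {m : ℝ} (hm : 0 ≤ m) {u : Site d → ℝ}
    (hu : ∀ j, u j ≤ m * gronwallWeight a lam κ j t) (j : Site d) :
    u j + ∑ k ∈ nbrs j, u k ≤
      m * (Real.exp 1 * (1 + 3 ^ d) * gronwallWeight a lam κ j t) := by
  set φ := gronwallWeight a lam κ j t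
  have hφ : 0 ≤ φ := gronwallWeight_nonneg a lam κ j t
  have hself : u j ≤ m * (Real.exp 1 * φ) := (hu j).trans (by
    gcongr
    exact le_mul_of_one_le_left hφ (Real.one_le_exp zero_le_one))
  have hnbrs : ∑ k ∈ nbrs j, u k ≤ 3 ^ d * (m * (Real.exp 1 * φ)) :=
    calc ∑ k ∈ nbrs j, u k ≤ ∑ _k ∈ nbrs j, m * (Real.exp 1 * φ) :=
          Finset.sum_le_sum fun k hk => (hu k).trans
            (mul_le_mul_of_nonneg_left (gronwallWeight_le_of_mem_nbrs hκ ht₀ ht hk) hm)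
      _ = (nbrs j).card * (m * (Real.exp 1 * φ)) := by rw [Finset.sum_const, nsmul_eq_mul]
      _ ≤ 3 ^ d * (m * (Real.exp 1 * φ)) := by
          gcongr
          exact_mod_cast card_nbrs_le j
  linarith

/-- The growth rate of the weight for which its derivative `lam log (e + |j| + κ) φ` dominates twice
a nearest neighbor coupling of strength `A log (e + |j|)`. -/
noncomputable def gronwallRate (d : ℕ) (A : ℝ) : ℝ := 1 + 2 * A * Real.exp 1 * (1 + 3 ^ d)

theorem one_le_gronwallRate (d : ℕ) {A : ℝ} (hA : 0 ≤ A) : 1 ≤ gronwallRate d A :=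
  le_add_of_nonneg_right (by positivity)

theorem coupling_le_gronwallWeight {A b m : ℝ} (hA : 0 ≤ A) (hb : 0 ≤ b) (hm : 0 ≤ m)
    (hκ : 0 ≤ κ) (ht₀ : 0 ≤ gronwallRate d A * t) (ht : α + gronwallRate d A * t ≤ κ)
    {u : Site d → ℝ} (hu₀ : ∀ j, 0 ≤ u j)
    (hu : ∀ j, u j ≤ m * gronwallWeight α (gronwallRate d A) κ j t) (j : Site d) :
    A * Real.log (siteWeight j) * (u j + ∑ k ∈ nbrs j, u k) + b * siteWeight j ^ α ≤
      (b + m / 2) * (gronwallRate d A * Real.log (siteWeight j + κ) *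
        gronwallWeight α (gronwallRate d A) κ j t) := by
  have hlam : 1 ≤ gronwallRate d A := one_le_gronwallRate d hA
  set φ := gronwallWeight α (gronwallRate d A) κ j t
  have hφ : 0 ≤ φ := gronwallWeight_nonneg _ _ κ j t
  set ℓ := Real.log (siteWeight j + κ)
  have hℓ : 1 ≤ ℓ := one_le_log_siteWeight_add hκ j
  have hφℓ : 0 ≤ ℓ * φ := mul_nonneg (zero_le_one.trans hℓ) hφ
  have hsource : b * siteWeight j ^ α ≤ b * (gronwallRate d A * ℓ * φ) := by
    gcongr
    exact (siteWeight_pow_le_gronwallWeight hκ ht₀ j).trans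
      (le_mul_of_one_le_left hφ (one_le_mul_of_one_le_of_one_le hlam hℓ))
  have hcoupling : A * Real.log (siteWeight j) * (u j + ∑ k ∈ nbrs j, u k) ≤
      A * ℓ * (m * (Real.exp 1 * (1 + 3 ^ d) * φ)) := by
    gcongr
    · exact add_nonneg (hu₀ j) (Finset.sum_nonneg fun k _ => hu₀ k)
    · exact log_siteWeight_le_log_add hκ j
    · exact add_sum_nbrs_le_gronwallWeight hκ (add_nonneg α.cast_nonneg ht₀) ht hm hu j
  calc _ ≤ A * ℓ * (m * (Real.exp 1 * (1 + 3 ^ d) * φ)) + b * (gronwallRate d A * ℓ * φ) :=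
        add_le_add hcoupling hsource
    _ = b * (gronwallRate d A * ℓ * φ) + m / 2 * ((gronwallRate d A - 1) * (ℓ * φ)) := by
        unfold gronwallRate
        ring
    _ ≤ (b + m / 2) * (gronwallRate d A * ℓ * φ) := by nlinarith [mul_nonneg hm hφℓ]

end GronwallWeight

theorem exists_weighted_gronwall_Icc (d : ℕ) {A T : ℝ} (hA : 0 ≤ A) (hT : 0 ≤ T) (α : ℕ) :
    ∃ (C : ℝ) (β : ℕ), 0 ≤ C ∧ ∀ {E : Type*} [NormedAddCommGroup E] [NormedSpace ℝ E]
      (w w' : ℝ → Site d → E) (b M τ : ℝ), 0 ≤ b → τ ∈ Icc 0 T →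
      (∀ t ∈ Icc 0 τ, ∀ j, HasDerivAt (fun s => w s j) (w' t j) t) →
      (∀ j, ‖w 0 j‖ ≤ b * siteWeight j ^ α) →
      (∀ t ∈ Icc 0 τ, ∀ j, ‖w' t j‖ ≤ A * Real.log (siteWeight j) *
        (‖w t j‖ + ∑ k ∈ nbrs j, ‖w t k‖) + b * siteWeight j ^ α) →
      (∀ t ∈ Icc 0 τ, ∀ j, ‖w t j‖ ≤ M * siteWeight j ^ α) →
      ∀ j, ‖w τ j‖ ≤ C * b * siteWeight j ^ β := by
  set lam : ℝ := gronwallRate d A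
  have hlam : 1 ≤ lam := one_le_gronwallRate d hA
  set κ : ℝ := α + lam * T
  have hκ : 0 ≤ κ := by positivity
  refine ⟨2 * (1 + κ) ^ ⌈κ⌉₊, ⌈κ⌉₊, by positivity, ?_⟩
  intro E _ _ w w' b M τ hb hτ hw hstart hderiv hprior
  set φ : Site d → ℝ → ℝ := gronwallWeight α lam κ
  have hφ : ∀ j t, 0 ≤ φ j t := gronwallWeight_nonneg α lam κ
  have hexp₀ : ∀ t ∈ Icc 0 τ, 0 ≤ lam * t := fun t ht =>
    mul_nonneg (zero_le_one.trans hlam) ht.1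
  have hexp : ∀ t ∈ Icc 0 τ, α + lam * t ≤ κ := fun t ht =>
    add_le_add le_rfl (mul_le_mul_of_nonneg_left (ht.2.trans hτ.2) (zero_le_one.trans hlam))
  have hpow : ∀ t ∈ Icc 0 τ, ∀ j, siteWeight j ^ α ≤ φ j t := fun t ht =>
    siteWeight_pow_le_gronwallWeight hκ (hexp₀ t ht)
  have hhalf : ∀ t ∈ Icc 0 τ, ∀ m, 0 ≤ m → (∀ j, ‖w t j‖ ≤ m * φ j t) →
      ∀ j, ‖w' t j‖ ≤ (b + m / 2) * (lam * Real.log (siteWeight j + κ) * φ j t) :=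
    fun t ht m hm hwm j => (hderiv t ht j).trans
      (coupling_le_gronwallWeight hA hb hm hκ (hexp₀ t ht) (hexp t ht) (fun _ => norm_nonneg _)
        hwm j)
  intro j
  have hτmem : τ ∈ Icc 0 τ := right_mem_Icc.2 hτ.1
  calc ‖w τ j‖ ≤ 2 * b * φ j τ :=
        norm_le_two_mul_of_norm_deriv_le_half hb (abs_nonneg M) hφ
          (hasDerivAt_gronwallWeight α lam κ) hw
          (fun j => (hstart j).trans
            (mul_le_mul_of_nonneg_left (hpow 0 (left_mem_Icc.2 hτ.1) j) hb)) hhalf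
          (fun t ht j => (hprior t ht j).trans (mul_le_mul (le_abs_self M) (hpow t ht j)
            (pow_nonneg (siteWeight_pos j).le _) (abs_nonneg M))) τ hτmem j
    _ ≤ 2 * b * ((1 + κ) * siteWeight j) ^ ⌈κ⌉₊ := by
        gcongr
        exact gronwallWeight_le hκ (hexp τ hτmem) j
    _ = _ := by
        rw [mul_pow]
        ring

theorem exists_weighted_gronwall (d : ℕ) {A T : ℝ} (hA : 0 ≤ A) (hT : 0 ≤ T) (α : ℕ) :
    ∃ (C : ℝ) (β : ℕ), 0 ≤ C ∧ ∀ {E : Type*} [NormedAddCommGroup E] [NormedSpace ℝ E]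
      (w w' : ℝ → Site d → E) (b M s t : ℝ), 0 ≤ b → |t - s| ≤ T →
      (∀ r ∈ uIcc s t, ∀ j, HasDerivAt (fun r => w r j) (w' r j) r) →
      (∀ j, ‖w s j‖ ≤ b * siteWeight j ^ α) →
      (∀ r ∈ uIcc s t, ∀ j, ‖w' r j‖ ≤ A * Real.log (siteWeight j) *
        (‖w r j‖ + ∑ k ∈ nbrs j, ‖w r k‖) + b * siteWeight j ^ α) →
      (∀ r ∈ uIcc s t, ∀ j, ‖w r j‖ ≤ M * siteWeight j ^ α) →
      ∀ j, ‖w t j‖ ≤ C * b * siteWeight j ^ β := by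
  obtain ⟨C, β, hC, h⟩ := exists_weighted_gronwall_Icc d hA hT α
  refine ⟨C, β, hC, fun {E} _ _ w w' b M s t hb hst hw hstart hderiv hprior => ?_⟩
  obtain ⟨σ, hσ, hend, hpath⟩ := exists_unit_speed_path s t
  simpa only [hend] using h (fun r => w (s + σ * r)) (fun r j => σ • w' (s + σ * r) j) b M |t - s|
    hb ⟨abs_nonneg _, hst⟩ (fun r hr j => hasDerivAt_comp_add_mul (hw _ (hpath r hr) j))
    (by simpa using hstart)
    (fun r hr j => by
      rw [norm_smul, Real.norm_eq_abs, hσ, one_mul]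
      exact hderiv _ (hpath r hr) j)
    (fun r hr => hprior _ (hpath r hr))

/-! ### The dynamics in a finite volume -/

/-- The force on the oscillator `i` of the system in `Λ` with free boundary conditions. -/
noncomputable def boxForce (K : ℝ) (U : ℝ[X]) (Λ : Finset (Site d)) (i : Site d) (x : Config d) :
    ℝ :=
  -(derivative U).eval (x i).1 -
    K * ∑ j ∈ Λ.filter (fun j => siteDist j i = 1), ((x i).1 - (x j).1)

/-- The energy of the system in `Λ` with free boundary conditions, in which the energy of the site
`i` and half of that of each of its bonds are weighted by `f i`. -/
noncomputable def boxEnergy (K : ℝ) (U : ℝ[X]) (Λ : Finset (Site d)) (f : Site d → ℝ)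
    (x : Config d) : ℝ :=
  ∑ i ∈ Λ, (f i * siteEnergy U (x i) +
    ∑ j ∈ Λ.filter (fun j => siteDist j i = 1), f i * (K / 4 * ((x i).1 - (x j).1) ^ 2))

section FiniteVolume

variable {K c : ℝ} {U : ℝ[X]} {Λ : Finset (Site d)}

theorem sum_boxForce_power (f : Site d → ℝ) (x : Config d) :
    ∑ i ∈ Λ, (f i * ((x i).2 * boxForce K U Λ i x + (derivative U).eval (x i).1 * (x i).2) +
      ∑ j ∈ Λ.filter (fun j => siteDist j i = 1),
        f i * (K / 2 * (((x i).1 - (x j).1) * ((x i).2 - (x j).2)))) =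
      K / 2 * ∑ i ∈ Λ, ∑ j ∈ Λ.filter (fun j => siteDist j i = 1),
        (f j - f i) * (((x i).1 - (x j).1) * (x i).2) := by
  set N : Site d → Finset (Site d) := fun i => Λ.filter (fun j => siteDist j i = 1)
  have hsite : ∀ i,
      f i * ((x i).2 * boxForce K U Λ i x + (derivative U).eval (x i).1 * (x i).2) +
        ∑ j ∈ N i, f i * (K / 2 * (((x i).1 - (x j).1) * ((x i).2 - (x j).2))) =
      ∑ j ∈ N i, -(K / 2) * (f i * ((x i).1 - (x j).1) * (x i).2) +
        ∑ j ∈ N i, -(K / 2) * (f i * ((x i).1 - (x j).1) * (x j).2) := fun i => by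
    have hforce : f i * ((x i).2 * boxForce K U Λ i x + (derivative U).eval (x i).1 * (x i).2) =
        ∑ j ∈ N i, -K * (f i * ((x i).1 - (x j).1) * (x i).2) := by
      unfold boxForce
      rw [← Finset.mul_sum, ← Finset.sum_mul, ← Finset.mul_sum]
      ring
    rw [hforce, ← Finset.sum_add_distrib, ← Finset.sum_add_distrib]
    exact Finset.sum_congr rfl fun j _ => by ring
  rw [Finset.sum_congr rfl fun i _ => hsite i, Finset.sum_add_distrib,
    sum_sum_filter_comm Λ fun i j => -(K / 2) * (f i * ((x i).1 - (x j).1) * (x j).2)]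
  rw [← Finset.sum_add_distrib, Finset.mul_sum]
  refine Finset.sum_congr rfl fun i _ => ?_
  rw [← Finset.sum_add_distrib, Finset.mul_sum]
  exact Finset.sum_congr rfl fun j _ => by ring

theorem hasDerivAt_boxEnergy (f : Site d → ℝ) {y : ℝ → Config d} {t a : ℝ}
    (hy : ∀ i ∈ Λ, HasDerivAt (fun s => y s i) (a • ((y t i).2, boxForce K U Λ i (y t))) t) :
    HasDerivAt (fun s => boxEnergy K U Λ f (y s))
      (a * (K / 2 * ∑ i ∈ Λ, ∑ j ∈ Λ.filter (fun j => siteDist j i = 1),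
        (f j - f i) * (((y t i).1 - (y t j).1) * (y t i).2))) t := by
  have hq : ∀ i ∈ Λ, HasDerivAt (fun s => (y s i).1) (a * (y t i).2) t := fun i hi => (hy i hi).fst
  have hp : ∀ i ∈ Λ, HasDerivAt (fun s => (y s i).2) (a * boxForce K U Λ i (y t)) t :=
    fun i hi => (hy i hi).snd
  have hsite : ∀ i ∈ Λ, HasDerivAt (fun s => siteEnergy U (y s i))
      (a * ((y t i).2 * boxForce K U Λ i (y t) + (derivative U).eval (y t i).1 * (y t i).2)) t :=
    fun i hi => by
      have hsum := ((((hp i hi).fun_pow 2).div_const 2).fun_add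
        ((U.hasDerivAt (y t i).1).comp t (hq i hi))).add_const 1
      refine hsum.congr_deriv ?_
      push_cast
      ring
  have hbond : ∀ i ∈ Λ, ∀ j ∈ Λ, HasDerivAt (fun s => K / 4 * ((y s i).1 - (y s j).1) ^ 2)
      (a * (K / 2 * (((y t i).1 - (y t j).1) * ((y t i).2 - (y t j).2)))) t := fun i hi j hj =>
    (((hq i hi).fun_sub (hq j hj)).fun_pow 2).const_mul (K / 4) |>.congr_deriv
      (by push_cast; ring)
  rw [← sum_boxForce_power (U := U), Finset.mul_sum]
  refine HasDerivAt.fun_sum fun i hi => ?_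
  refine (((hsite i hi).const_mul (f i)).add (HasDerivAt.fun_sum fun j hj =>
    (hbond i hi j (Finset.mem_filter.1 hj).1).const_mul (f i))).congr_deriv ?_
  rw [mul_add a (f i * _), Finset.mul_sum]
  exact congrArg₂ _ (by ring) (Finset.sum_congr rfl fun j _ => by ring)

theorem siteEnergy_le_boxEnergy_one (hK : 0 ≤ K) (hc : GrowthBounds U c) (x : Config d)
    {i : Site d} (hi : i ∈ Λ) : siteEnergy U (x i) ≤ boxEnergy K U Λ (fun _ => 1) x := by
  have hpos : ∀ j, 0 ≤ siteEnergy U (x j) := fun j => hc.siteEnergy_nonneg _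
  have hbonds : ∀ i, 0 ≤ ∑ j ∈ Λ.filter (fun j => siteDist j i = 1),
      K / 4 * ((x i).1 - (x j).1) ^ 2 := fun i => by positivity
  simp only [boxEnergy, one_mul]
  exact (le_add_of_nonneg_right (hbonds i)).trans
    (Finset.single_le_sum (f := fun i => siteEnergy U (x i) +
      ∑ j ∈ Λ.filter (fun j => siteDist j i = 1), K / 4 * ((x i).1 - (x j).1) ^ 2)
      (fun j _ => add_nonneg (hpos j) (hbonds j)) hi)

theorem boxEnergy_one_eq {T : ℝ} {y : ℝ → Config d} {a : ℝ → ℝ}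
    (hy : ∀ t ∈ Ioo (-T) T, ∀ i ∈ Λ,
      HasDerivAt (fun s => y s i) (a t • ((y t i).2, boxForce K U Λ i (y t))) t)
    {t : ℝ} (ht : t ∈ Ioo (-T) T) :
    boxEnergy K U Λ (fun _ => 1) (y t) = boxEnergy K U Λ (fun _ => 1) (y 0) := by
  have hderiv : ∀ s ∈ Ioo (-T) T,
      HasDerivAt (fun s => boxEnergy K U Λ (fun _ => 1) (y s)) 0 s := fun s hs => by
    simpa using hasDerivAt_boxEnergy (fun _ => 1) (hy s hs)
  exact isOpen_Ioo.is_const_of_deriv_eq_zero isPreconnected_Ioo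
    (fun s hs => (hderiv s hs).differentiableAt.differentiableWithinAt)
    (fun s hs => (hderiv s hs).deriv) ht
    (by constructor <;> linarith [ht.1, ht.2])

theorem exists_solution_of_lipschitz {E : Type*} [NormedAddCommGroup E] [NormedSpace ℝ E]
    [CompleteSpace E] {v : E → E} {k : NNReal} (hv : LipschitzWith k v) {L : ℝ}
    (hL : ∀ u, ‖v u‖ ≤ L) (u₀ : E) {T : ℝ} (hT : 0 < T) :
    ∃ u : ℝ → E, u 0 = u₀ ∧ ∀ t ∈ Ioo (-T) T, HasDerivAt u (v (u t)) t := by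
  have hL₀ : 0 ≤ L := (norm_nonneg _).trans (hL u₀)
  have hT₀ : (0 : ℝ) ∈ Icc (-T) T := ⟨by linarith, hT.le⟩
  have hpl : IsPicardLindelof (fun _ => v) (tmin := -T) (tmax := T) ⟨0, hT₀⟩ u₀
      ⟨L * T, by positivity⟩ 0 ⟨L, hL₀⟩ k :=
    IsPicardLindelof.of_time_independent (fun u _ => hL u) hv.lipschitzOnWith (by
      simp only [sub_zero, zero_sub, neg_neg, max_self, NNReal.coe_zero]
      exact le_rfl)
  obtain ⟨u, hu₀, hu⟩ := hpl.exists_eq_forall_mem_Icc_hasDerivWithinAt₀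
  exact ⟨u, hu₀, fun t ht => (hu t (Ioo_subset_Icc_self ht)).hasDerivAt (Icc_mem_nhds ht.1 ht.2)⟩

/-- Truncating the field by a cutoff only changes the speed along its orbits, so that an a priori
bound on the orbits, whatever their parametrization, makes the truncation invisible. -/
theorem exists_solution_of_bounded_orbits {E : Type*} [NormedAddCommGroup E] [NormedSpace ℝ E]
    [FiniteDimensional ℝ E] {v : E → E} (hv : ContDiff ℝ 1 v) (u₀ : E) {T R : ℝ} (hT : 0 < T)
    (hbound : ∀ (u : ℝ → E) (a : ℝ → ℝ), u 0 = u₀ →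
      (∀ t ∈ Ioo (-T) T, HasDerivAt u (a t • v (u t)) t) → ∀ t ∈ Ioo (-T) T, ‖u t‖ ≤ R) :
    ∃ u : ℝ → E, u 0 = u₀ ∧ ∀ t ∈ Ioo (-T) T, HasDerivAt u (v (u t)) t := by
  have : CompleteSpace E := FiniteDimensional.complete ℝ E
  let χ : ContDiffBump (0 : E) := ⟨|R| + 1, |R| + 2, by positivity, by linarith⟩
  have hχv : ContDiff ℝ 1 fun u => χ u • v u := χ.contDiff.smul hv
  have hχc : HasCompactSupport fun u => χ u • v u := χ.hasCompactSupport.smul_right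
  obtain ⟨k, hk⟩ := hχv.lipschitzWith_of_hasCompactSupport hχc one_ne_zero
  obtain ⟨L, hL⟩ := hχc.exists_bound_of_continuous hχv.continuous
  obtain ⟨u, hu₀, hu⟩ := exists_solution_of_lipschitz hk hL u₀ hT
  refine ⟨u, hu₀, fun t ht => ?_⟩
  have hχ : χ (u t) = 1 := χ.one_of_mem_closedBall <| by
    rw [mem_closedBall_zero_iff]
    exact (hbound u (fun t => χ (u t)) hu₀ hu t ht).trans
      ((le_abs_self R).trans (le_add_of_nonneg_right zero_le_one))
  simpa only [hχ, one_smul] using hu t ht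

/-- The configuration which is `u` in `Λ` and `x` outside. -/
def boxExtend (Λ : Finset (Site d)) (x : Config d) (u : Λ → ℝ × ℝ) : Config d :=
  fun i => if h : i ∈ Λ then u ⟨i, h⟩ else x i

theorem boxExtend_of_mem (x : Config d) (u : Λ → ℝ × ℝ) {i : Site d} (hi : i ∈ Λ) :
    boxExtend Λ x u i = u ⟨i, hi⟩ :=
  dif_pos hi

theorem boxExtend_of_notMem (x : Config d) (u : Λ → ℝ × ℝ) {i : Site d} (hi : i ∉ Λ) :
    boxExtend Λ x u i = x i :=
  dif_neg hi

theorem boxExtend_restrict (x : Config d) : boxExtend Λ x (fun i => x i) = x := by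
  funext i
  by_cases hi : i ∈ Λ
  · exact boxExtend_of_mem x _ hi
  · exact boxExtend_of_notMem x _ hi

theorem contDiff_boxExtend_apply (Λ : Finset (Site d)) (x : Config d) (i : Site d) :
    ContDiff ℝ 1 fun u => boxExtend Λ x u i := by
  by_cases hi : i ∈ Λ
  · simp only [boxExtend_of_mem x _ hi]
    exact contDiff_apply ℝ _ _
  · simp only [boxExtend_of_notMem x _ hi]
    exact contDiff_const

theorem contDiff_boxForce_boxExtend (K : ℝ) (U : ℝ[X]) (Λ : Finset (Site d)) (x : Config d)
    (i : Site d) : ContDiff ℝ 1 fun u => boxForce K U Λ i (boxExtend Λ x u) := by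
  have hpoly : ContDiff ℝ 1 fun r : ℝ => (derivative U).eval r := by
    simpa using (derivative U).contDiff_aeval (𝕜 := ℝ) 1
  have hq : ∀ j, ContDiff ℝ 1 fun u => (boxExtend Λ x u j).1 := fun j =>
    contDiff_fst.comp (contDiff_boxExtend_apply Λ x j)
  exact (hpoly.comp (hq i)).neg.sub
    (contDiff_const.mul (ContDiff.sum fun j _ => (hq i).sub (hq j)))

theorem exists_box_solution (hK : 0 ≤ K) (hc : GrowthBounds U c) (Λ : Finset (Site d))
    (x : Config d) {T : ℝ} (hT : 0 < T) :
    ∃ y : ℝ → Config d, y 0 = x ∧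
      (∀ t ∈ Ioo (-T) T, ∀ i ∈ Λ,
        HasDerivAt (fun s => y s i) ((y t i).2, boxForce K U Λ i (y t)) t) ∧
      ∀ t, ∀ i ∉ Λ, y t i = x i := by
  set v : (Λ → ℝ × ℝ) → Λ → ℝ × ℝ := fun u i =>
    ((boxExtend Λ x u i).2, boxForce K U Λ i (boxExtend Λ x u))
  have hv : ContDiff ℝ 1 v := contDiff_pi.2 fun i =>
    (contDiff_snd.comp (contDiff_boxExtend_apply Λ x i)).prodMk
      (contDiff_boxForce_boxExtend K U Λ x i)
  have hcoord : ∀ (u : ℝ → Λ → ℝ × ℝ) (a t : ℝ), HasDerivAt u (a • v (u t)) t → ∀ i ∈ Λ,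
      HasDerivAt (fun s => boxExtend Λ x (u s) i)
        (a • ((boxExtend Λ x (u t) i).2, boxForce K U Λ i (boxExtend Λ x (u t)))) t :=
    fun u a t hu i hi => by
      have hi' := hasDerivAt_pi.1 hu ⟨i, hi⟩
      rwa [← funext fun s => boxExtend_of_mem x (u s) hi] at hi'
  obtain ⟨u, hu₀, hu⟩ := exists_solution_of_bounded_orbits hv (fun i : Λ => x i) (T := T)
    (R := c * |boxEnergy K U Λ (fun _ => 1) x|) hT fun u a hu₀ hu t ht => by
      have hc₀ : 0 ≤ c := zero_le_one.trans hc.one_le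
      refine (pi_norm_le_iff_of_nonneg (by positivity)).2 fun i => (hc.norm_le (u t i)).trans ?_
      have hE := siteEnergy_le_boxEnergy_one hK hc (boxExtend Λ x (u t)) i.2
      rw [boxEnergy_one_eq (fun t ht => hcoord u (a t) t (hu t ht)) ht, hu₀, boxExtend_restrict,
        boxExtend_of_mem x _ i.2] at hE
      exact mul_le_mul_of_nonneg_left (hE.trans (le_abs_self _)) hc₀
  refine ⟨fun t => boxExtend Λ x (u t), (congrArg _ hu₀).trans (boxExtend_restrict x),
    fun t ht i hi => ?_, fun t i hi => boxExtend_of_notMem x _ hi⟩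
  simpa only [one_smul] using hcoord u 1 t (by simpa only [one_smul] using hu t ht) i hi

end FiniteVolume

/-! ### The energy estimate -/

/-- The distance `max_ℓ |i_ℓ - ν_ℓ|`, whose balls are the cubes. -/
def supDist (ν i : Site d) : ℕ := Finset.univ.sup fun l => (i l - ν l).natAbs

theorem mem_cube_iff_supDist_le {ν i : Site d} {k : ℕ} : i ∈ cube ν k ↔ supDist ν i ≤ k := by
  simp only [mem_cube, supDist, Finset.sup_le_iff, Finset.mem_univ, true_imp_iff]
  exact forall_congr' fun l => by rw [Int.abs_eq_natAbs, Nat.cast_le]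

theorem supDist_le_of_siteDist_eq_one {ν i j : Site d} (h : siteDist j i = 1) :
    supDist ν j ≤ supDist ν i + 1 := by
  have hj : j ∈ cube i 1 := (Finset.mem_filter.1 (mem_nbrs.2 h)).1
  rw [mem_cube] at hj
  refine Finset.sup_le fun l _ => ?_
  have hi : (i l - ν l).natAbs ≤ supDist ν i :=
    Finset.le_sup (f := fun l => (i l - ν l).natAbs) (Finset.mem_univ l)
  have hjl := abs_le.1 (hj l)
  omega

/-- A weight which is of order one on `cube ν k` and decays exponentially, on the scale `k`. -/
noncomputable def cubeWeight (ν : Site d) (k : ℕ) (i : Site d) : ℝ :=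
  (2⁻¹ : ℝ) ^ (supDist ν i / k)

theorem cubeWeight_nonneg (ν : Site d) (k : ℕ) (i : Site d) : 0 ≤ cubeWeight ν k i := by
  unfold cubeWeight
  positivity

theorem cubeWeight_le_of_siteDist_eq_one (ν : Site d) {k : ℕ} (hk : 1 ≤ k) {i j : Site d}
    (h : siteDist j i = 1) : cubeWeight ν k i ≤ 2 * cubeWeight ν k j := by
  have hdist : supDist ν j / k ≤ supDist ν i / k + 1 := by
    calc supDist ν j / k ≤ (supDist ν i + k) / k :=
          Nat.div_le_div_right ((supDist_le_of_siteDist_eq_one h).trans (by omega))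
      _ = _ := Nat.add_div_right _ (by omega)
  have hpow : (2⁻¹ : ℝ) ^ (supDist ν i / k + 1) ≤ (2⁻¹ : ℝ) ^ (supDist ν j / k) :=
    pow_le_pow_of_le_one (by norm_num) (by norm_num) hdist
  unfold cubeWeight
  rw [pow_succ] at hpow
  linarith

theorem half_le_cubeWeight {ν i : Site d} {k : ℕ} (hi : i ∈ cube ν k) :
    1 / 2 ≤ cubeWeight ν k i := by
  have hdist : supDist ν i / k ≤ 1 :=
    Nat.div_le_of_le_mul (by simpa only [mul_one] using mem_cube_iff_supDist_le.1 hi)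
  have hpow : (2⁻¹ : ℝ) ^ 1 ≤ (2⁻¹ : ℝ) ^ (supDist ν i / k) :=
    pow_le_pow_of_le_one (by norm_num) (by norm_num) hdist
  unfold cubeWeight
  linarith

theorem cubeWeight_mul_le_sum_range (ν i : Site d) {k N : ℕ} (hk : 1 ≤ k)
    (hN : supDist ν i / k < N) {b : ℝ} (hb : 0 ≤ b) : cubeWeight ν k i * b ≤
      ∑ m ∈ Finset.range N, if i ∈ cube ν ((m + 1) * k) then (2⁻¹ : ℝ) ^ m * b else 0 := by
  have hi : i ∈ cube ν ((supDist ν i / k + 1) * k) := by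
    rw [mem_cube_iff_supDist_le, mul_comm]
    exact (Nat.lt_mul_div_succ _ hk).le
  calc cubeWeight ν k i * b =
      if i ∈ cube ν ((supDist ν i / k + 1) * k) then (2⁻¹ : ℝ) ^ (supDist ν i / k) * b else 0 := by
        rw [if_pos hi, cubeWeight]
    _ ≤ _ := Finset.single_le_sum
        (f := fun m => if i ∈ cube ν ((m + 1) * k) then (2⁻¹ : ℝ) ^ m * b else 0)
        (fun m _ => by positivity) (Finset.mem_range.2 hN)

theorem summable_two_inv_pow_mul_succ_pow (d : ℕ) :
    Summable fun m : ℕ => (2⁻¹ : ℝ) ^ m * ((m : ℝ) + 1) ^ d := by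
  have hgeom : Summable fun m : ℕ => (m : ℝ) ^ d * (2⁻¹ : ℝ) ^ m :=
    summable_pow_mul_geometric_of_norm_lt_one d (by norm_num)
  refine (((summable_nat_add_iff 1).2 hgeom).mul_left 2).congr fun m => ?_
  push_cast
  rw [pow_succ]
  ring

theorem exists_sum_cubeWeight_le (d : ℕ) : ∃ C : ℝ, 1 ≤ C ∧
    ∀ (ν : Site d) (k : ℕ), 1 ≤ k → ∀ (b : Site d → ℝ) (M : ℝ), (∀ i, 0 ≤ b i) → 0 ≤ M →
      (∀ m : ℕ, k ≤ m → ∑ i ∈ cube ν m, b i ≤ M * (2 * (m : ℝ) + 1) ^ d) →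
      ∀ Λ : Finset (Site d), ∑ i ∈ Λ, cubeWeight ν k i * b i ≤ C * M * (2 * (k : ℝ) + 1) ^ d := by
  refine ⟨1 + ∑' m : ℕ, (2⁻¹ : ℝ) ^ m * ((m : ℝ) + 1) ^ d,
    le_add_of_nonneg_right (tsum_nonneg fun m => by positivity), ?_⟩
  intro ν k hk b M hb hM h Λ
  set N := Λ.sup (fun i => supDist ν i / k) + 1
  have hcube : ∀ m : ℕ, ∑ i ∈ Λ ∩ cube ν ((m + 1) * k), b i ≤
      ((m : ℝ) + 1) ^ d * (M * (2 * (k : ℝ) + 1) ^ d) := fun m => by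
    have hside : 2 * (((m + 1) * k : ℕ) : ℝ) + 1 ≤ ((m : ℝ) + 1) * (2 * (k : ℝ) + 1) := by
      push_cast
      have : (0 : ℝ) ≤ m := Nat.cast_nonneg m
      linarith
    calc ∑ i ∈ Λ ∩ cube ν ((m + 1) * k), b i
        ≤ ∑ i ∈ cube ν ((m + 1) * k), b i :=
          Finset.sum_le_sum_of_subset_of_nonneg Finset.inter_subset_right fun i _ _ => hb i
      _ ≤ M * (2 * (((m + 1) * k : ℕ) : ℝ) + 1) ^ d := h _ (Nat.le_mul_of_pos_left k m.succ_pos)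
      _ ≤ M * (((m : ℝ) + 1) * (2 * (k : ℝ) + 1)) ^ d := by gcongr
      _ = _ := by rw [mul_pow]; ring
  calc ∑ i ∈ Λ, cubeWeight ν k i * b i
      ≤ ∑ i ∈ Λ, ∑ m ∈ Finset.range N,
          if i ∈ cube ν ((m + 1) * k) then (2⁻¹ : ℝ) ^ m * b i else 0 :=
        Finset.sum_le_sum fun i hi => cubeWeight_mul_le_sum_range ν i hk
          (Nat.lt_succ_of_le (Finset.le_sup (f := fun i => supDist ν i / k) hi)) (hb i)
    _ = ∑ m ∈ Finset.range N, (2⁻¹ : ℝ) ^ m * ∑ i ∈ Λ ∩ cube ν ((m + 1) * k), b i := by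
        rw [Finset.sum_comm]
        simp only [Finset.sum_ite_mem, Finset.mul_sum]
    _ ≤ ∑ m ∈ Finset.range N,
          (2⁻¹ : ℝ) ^ m * (((m : ℝ) + 1) ^ d * (M * (2 * (k : ℝ) + 1) ^ d)) := by
        gcongr with m
        exact hcube m
    _ = (∑ m ∈ Finset.range N, (2⁻¹ : ℝ) ^ m * ((m : ℝ) + 1) ^ d) *
          (M * (2 * (k : ℝ) + 1) ^ d) := by
        simp only [← mul_assoc, Finset.sum_mul]
    _ ≤ _ := by
        rw [mul_assoc (1 + _)]
        gcongr
        exact ((summable_two_inv_pow_mul_succ_pow d).sum_le_tsum _ fun m _ => by positivity).trans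
          (le_add_of_nonneg_left zero_le_one)

theorem abs_mul_abs_le_div_add_pow {p q T : ℝ} (hT : 0 < T) :
    |p| * |q| ≤ (p ^ 2 / 2 + q ^ 4) / T + T ^ 3 := by
  have hpq : |p| * |q| ≤ p ^ 2 / 2 / T + q ^ 2 * T / 2 := by
    have hsq : (|p| - |q| * T) ^ 2 / (2 * T) = p ^ 2 / 2 / T + q ^ 2 * T / 2 - |p| * |q| := by
      rw [sub_sq, mul_pow, sq_abs, sq_abs]
      field_simp
      ring
    have : 0 ≤ (|p| - |q| * T) ^ 2 / (2 * T) := by positivity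
    linarith
  have hq : q ^ 2 * T / 2 ≤ q ^ 4 / T + T ^ 3 := by
    have hsq : (q ^ 2 - T ^ 2) ^ 2 / (4 * T) = q ^ 4 / T / 4 - q ^ 2 * T / 2 + T ^ 3 / 4 := by
      field_simp
      ring
    have : 0 ≤ (q ^ 2 - T ^ 2) ^ 2 / (4 * T) := by positivity
    have : 0 ≤ q ^ 4 / T := by positivity
    have : 0 ≤ T ^ 3 := by positivity
    linarith
  rw [add_div]
  linarith

section EnergyEstimate

variable {K c M : ℝ} {U : ℝ[X]} {Λ : Finset (Site d)} {f : Site d → ℝ}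

theorem GrowthBounds.abs_snd_mul_abs_fst_le (hc : GrowthBounds U c) (z w : ℝ × ℝ) {T : ℝ}
    (hT : 0 < T) : |z.2| * |w.1| ≤ (siteEnergy U z + c * siteEnergy U w) / T + T ^ 3 := by
  have hkin : z.2 ^ 2 / 2 ≤ siteEnergy U z := by
    have := hc.eval_nonneg z.1
    unfold siteEnergy
    linarith
  have hpot := hc.pow_four_le w
  exact (abs_mul_abs_le_div_add_pow hT).trans (by gcongr)

theorem GrowthBounds.abs_mul_bond_power_le (hc : GrowthBounds U c) {a b : ℝ} (ha : 0 ≤ a)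
    (hab : a ≤ 2 * b) (hba : b ≤ 2 * a) (z w : ℝ × ℝ) {T : ℝ} (hT : 0 < T) :
    |(b - a) * ((z.1 - w.1) * z.2)| ≤
      3 * c / T * (a * siteEnergy U z) + 2 * c / T * (b * siteEnergy U w) + 2 * T ^ 3 * a := by
  have hz := hc.siteEnergy_nonneg z
  have hw := hc.siteEnergy_nonneg w
  have hc₁ := hc.one_le
  have hsub : |b - a| ≤ a := abs_le.2 ⟨by linarith, by linarith⟩
  have hpower : |(z.1 - w.1) * z.2| ≤
      (2 * siteEnergy U z + c * siteEnergy U z + c * siteEnergy U w) / T + 2 * T ^ 3 := by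
    have hsplit : |(z.1 - w.1) * z.2| ≤ |z.2| * |z.1| + |z.2| * |w.1| := by
      rw [abs_mul, mul_comm, ← mul_add]
      exact mul_le_mul_of_nonneg_left (abs_sub _ _) (abs_nonneg _)
    refine (hsplit.trans (add_le_add (hc.abs_snd_mul_abs_fst_le z z hT)
      (hc.abs_snd_mul_abs_fst_le z w hT))).trans_eq ?_
    ring
  have hshift : a * (2 * siteEnergy U z + c * siteEnergy U z + c * siteEnergy U w) ≤
      3 * c * (a * siteEnergy U z) + 2 * c * (b * siteEnergy U w) := by
    have hleft : 2 * (a * siteEnergy U z) ≤ 2 * c * (a * siteEnergy U z) := by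
      gcongr
      linarith
    have hright : a * (c * siteEnergy U w) ≤ 2 * b * (c * siteEnergy U w) := by gcongr
    linarith
  calc |(b - a) * ((z.1 - w.1) * z.2)|
      ≤ a * ((2 * siteEnergy U z + c * siteEnergy U z + c * siteEnergy U w) / T + 2 * T ^ 3) := by
        rw [abs_mul]
        exact mul_le_mul hsub hpower (abs_nonneg _) ha
    _ = a * (2 * siteEnergy U z + c * siteEnergy U z + c * siteEnergy U w) / T +
          2 * T ^ 3 * a := by ring
    _ ≤ (3 * c * (a * siteEnergy U z) + 2 * c * (b * siteEnergy U w)) / T + 2 * T ^ 3 * a := by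
        gcongr
    _ = _ := by ring

theorem sum_mul_siteEnergy_le_boxEnergy (hK : 0 ≤ K) (U : ℝ[X]) (Λ : Finset (Site d))
    (hf : ∀ i, 0 ≤ f i) (x : Config d) :
    ∑ i ∈ Λ, f i * siteEnergy U (x i) ≤ boxEnergy K U Λ f x :=
  Finset.sum_le_sum fun i _ => le_add_of_nonneg_right <|
    Finset.sum_nonneg fun _ _ => mul_nonneg (hf i) (by positivity)

theorem boxEnergy_nonneg (hK : 0 ≤ K) (hc : GrowthBounds U c) (Λ : Finset (Site d))
    (hf : ∀ i, 0 ≤ f i) (x : Config d) : 0 ≤ boxEnergy K U Λ f x :=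
  (Finset.sum_nonneg fun i _ => mul_nonneg (hf i) (hc.siteEnergy_nonneg _)).trans
    (sum_mul_siteEnergy_le_boxEnergy hK U Λ hf x)

theorem boxEnergy_le (hK : 0 ≤ K) (hc : GrowthBounds U c) (Λ : Finset (Site d))
    (hf : ∀ i, 0 ≤ f i) (hff : ∀ i j, siteDist j i = 1 → f i ≤ 2 * f j) (x : Config d) :
    boxEnergy K U Λ f x ≤ (1 + 2 * K * c * 3 ^ d) * ∑ i ∈ Λ, f i * siteEnergy U (x i) := by
  rw [boxEnergy, Finset.sum_add_distrib, add_mul, one_mul]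
  exact add_le_add_right (sum_mul_bond_le hK hc Λ x hf hff) _

theorem sum_cube_inter_siteEnergy_le (hK : 0 ≤ K) (hc : GrowthBounds U c) (ν : Site d) (k : ℕ)
    (Λ : Finset (Site d)) (x : Config d) :
    ∑ i ∈ cube ν k ∩ Λ, siteEnergy U (x i) ≤ 2 * boxEnergy K U Λ (cubeWeight ν k) x := by
  have hE : ∀ i, 0 ≤ siteEnergy U (x i) := fun i => hc.siteEnergy_nonneg _
  have hf := cubeWeight_nonneg ν k
  calc ∑ i ∈ cube ν k ∩ Λ, siteEnergy U (x i)
      ≤ ∑ i ∈ cube ν k ∩ Λ, 2 * (cubeWeight ν k i * siteEnergy U (x i)) := by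
        refine Finset.sum_le_sum fun i hi => ?_
        have := mul_le_mul_of_nonneg_right (half_le_cubeWeight (Finset.mem_inter.1 hi).1) (hE i)
        linarith
    _ ≤ ∑ i ∈ Λ, 2 * (cubeWeight ν k i * siteEnergy U (x i)) :=
        Finset.sum_le_sum_of_subset_of_nonneg Finset.inter_subset_right fun i _ _ =>
          mul_nonneg zero_le_two (mul_nonneg (hf i) (hE i))
    _ = 2 * ∑ i ∈ Λ, cubeWeight ν k i * siteEnergy U (x i) := (Finset.mul_sum ..).symm
    _ ≤ _ := by
        gcongr
        exact sum_mul_siteEnergy_le_boxEnergy hK U Λ hf x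

theorem abs_boxEnergy_flux_le (hK : 0 ≤ K) (hc : GrowthBounds U c) (Λ : Finset (Site d))
    (hf : ∀ i, 0 ≤ f i) (hff : ∀ i j, siteDist j i = 1 → f i ≤ 2 * f j) (x : Config d) {T : ℝ}
    (hT : 0 < T) :
    |K / 2 * ∑ i ∈ Λ, ∑ j ∈ Λ.filter (fun j => siteDist j i = 1),
        (f j - f i) * (((x i).1 - (x j).1) * (x i).2)| ≤
      3 * K * c * 3 ^ d / T * boxEnergy K U Λ f x + K * 3 ^ d * T ^ 3 * ∑ i ∈ Λ, f i := by
  have hc₀ : 0 ≤ c := zero_le_one.trans hc.one_le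
  have hfE : ∀ i, 0 ≤ f i * siteEnergy U (x i) := fun i =>
    mul_nonneg (hf i) (hc.siteEnergy_nonneg _)
  set A := ∑ i ∈ Λ, f i * siteEnergy U (x i)
  have hA : 0 ≤ A := Finset.sum_nonneg fun i _ => hfE i
  have hbond : ∀ i, ∀ j ∈ Λ.filter (fun j => siteDist j i = 1),
      |(f j - f i) * (((x i).1 - (x j).1) * (x i).2)| ≤ 3 * c / T * (f i * siteEnergy U (x i)) +
        2 * c / T * (f j * siteEnergy U (x j)) + 2 * T ^ 3 * f i := fun i j hj => by
    have hij := (Finset.mem_filter.1 hj).2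
    exact hc.abs_mul_bond_power_le (hf i) (hff i j hij)
      (hff j i ((siteDist_comm i j).trans hij)) _ _ hT
  have hsum : |∑ i ∈ Λ, ∑ j ∈ Λ.filter (fun j => siteDist j i = 1),
      (f j - f i) * (((x i).1 - (x j).1) * (x i).2)| ≤
      3 * c / T * (3 ^ d * A) + 2 * c / T * (3 ^ d * A) + 2 * T ^ 3 * (3 ^ d * ∑ i ∈ Λ, f i) := by
    refine (Finset.abs_sum_le_sum_abs _ _).trans ((Finset.sum_le_sum fun i _ =>
      (Finset.abs_sum_le_sum_abs _ _).trans (Finset.sum_le_sum (hbond i))).trans ?_)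
    simp only [Finset.sum_add_distrib, ← Finset.mul_sum]
    have hleft := sum_sum_filter_left_le Λ hfE
    have hright := sum_sum_filter_right_le Λ hfE
    have hweight := sum_sum_filter_left_le Λ hf
    simp only [← Finset.mul_sum] at hleft
    gcongr
  rw [abs_mul, abs_of_nonneg (by positivity : 0 ≤ K / 2)]
  calc _ ≤ K / 2 * (3 * c / T * (3 ^ d * A) + 2 * c / T * (3 ^ d * A) +
        2 * T ^ 3 * (3 ^ d * ∑ i ∈ Λ, f i)) := by gcongr
    _ = 5 / 2 * (K * c * 3 ^ d / T * A) + K * 3 ^ d * T ^ 3 * ∑ i ∈ Λ, f i := by ring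
    _ ≤ 3 * (K * c * 3 ^ d / T * boxEnergy K U Λ f x) + K * 3 ^ d * T ^ 3 * ∑ i ∈ Λ, f i := by
        gcongr
        · norm_num
        · exact sum_mul_siteEnergy_le_boxEnergy hK U Λ hf x
    _ = _ := by ring

theorem boxEnergy_le_exp_mul (hK : 0 ≤ K) (hc : GrowthBounds U c) (hf : ∀ i, 0 ≤ f i)
    (hff : ∀ i j, siteDist j i = 1 → f i ≤ 2 * f j) {y : ℝ → Config d} {t : ℝ}
    (hy : ∀ s ∈ uIcc 0 t, ∀ i ∈ Λ,
      HasDerivAt (fun r => y r i) ((y s i).2, boxForce K U Λ i (y s)) s) :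
    boxEnergy K U Λ f (y t) ≤ Real.exp (3 * K * c * 3 ^ d) *
      (boxEnergy K U Λ f (y 0) + t ^ 4 * ∑ i ∈ Λ, f i) := by
  have hc₁ := hc.one_le
  have hboxEnergy : ∀ x : Config d, 0 ≤ boxEnergy K U Λ f x := boxEnergy_nonneg hK hc Λ hf
  rcases eq_or_ne t 0 with rfl | ht
  · simpa using le_mul_of_one_le_left (hboxEnergy (y 0)) (Real.one_le_exp (by positivity))
  set T := |t|
  have hT : 0 < T := abs_pos.2 ht
  have hT₄ : T ^ 4 = t ^ 4 := Even.pow_abs (by decide) t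
  set S := ∑ i ∈ Λ, f i
  have hS : 0 ≤ S := Finset.sum_nonneg fun i _ => hf i
  -- The constant `T ^ 4 * S` absorbs the inhomogeneous term of the differential inequality.
  set E : ℝ → ℝ := fun r => boxEnergy K U Λ f (y r) + T ^ 4 * S
  have hE : ∀ r, ‖E r‖ = E r := fun r =>
    Real.norm_of_nonneg (add_nonneg (hboxEnergy _) (by positivity))
  have hderiv : ∀ r ∈ uIcc 0 t, HasDerivAt E (K / 2 * ∑ i ∈ Λ,
      ∑ j ∈ Λ.filter (fun j => siteDist j i = 1),
        (f j - f i) * (((y r i).1 - (y r j).1) * (y r i).2)) r := fun r hr => by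
    simpa only [one_mul] using (hasDerivAt_boxEnergy (a := 1) f
      (by simpa only [one_smul] using hy r hr)).add_const (T ^ 4 * S)
  have habsorb : ∀ x : Config d, 3 * K * c * 3 ^ d / T * boxEnergy K U Λ f x +
      K * 3 ^ d * T ^ 3 * S ≤ 3 * K * c * 3 ^ d / T * (boxEnergy K U Λ f x + T ^ 4 * S) := by
    intro x
    have hconst : K * 3 ^ d * T ^ 3 * S ≤ 3 * c * (K * 3 ^ d * T ^ 3 * S) :=
      le_mul_of_one_le_left (by positivity) (by linarith)
    rw [mul_add]
    refine add_le_add_right (hconst.trans_eq ?_) _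
    field_simp
  have hgronwall := norm_le_exp_mul_of_norm_deriv_le hderiv fun r _ => by
    rw [hE, Real.norm_eq_abs]
    exact (abs_boxEnergy_flux_le hK hc Λ hf hff (y r) hT).trans (habsorb _)
  rw [sub_zero, div_mul_cancel₀ _ hT.ne', hE, hE] at hgronwall
  rw [← hT₄]
  exact (le_add_of_nonneg_right (by positivity)).trans hgronwall

theorem exists_box_energyBound (hK : 0 ≤ K) (hc : GrowthBounds U c) (hd : 1 ≤ d) :
    ∃ C : ℝ, 1 ≤ C ∧ ∀ (Λ : Finset (Site d)) (y : ℝ → Config d) (M t : ℝ),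
      EnergyBound U M (y 0) →
      (∀ s ∈ uIcc 0 t, ∀ i ∈ Λ, HasDerivAt (fun r => y r i)
        ((y s i).2, boxForce K U Λ i (y s)) s) →
      (∀ i ∉ Λ, y t i = y 0 i) → EnergyBound U (C * (M + t ^ 4)) (y t) := by
  obtain ⟨C₁, hC₁, hsum⟩ := exists_sum_cubeWeight_le d
  have hc₀ : 0 ≤ c := zero_le_one.trans hc.one_le
  set κ := 3 * K * c * 3 ^ d
  set B := 1 + 2 * K * c * 3 ^ d
  have hB : 1 ≤ B := le_add_of_nonneg_right (by positivity)
  refine ⟨2 * Real.exp κ * (B * C₁) + 1, le_add_of_nonneg_left (by positivity), ?_⟩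
  intro Λ y M t hM hy hout ν k hk
  have hk₁ := one_le_of_log_siteWeight_rpow_lt hk
  have hE : ∀ s i, 0 ≤ siteEnergy U (y s i) := fun s i => hc.siteEnergy_nonneg _
  set V : ℝ := (2 * (k : ℝ) + 1) ^ d
  have hweight : ∑ i ∈ Λ, cubeWeight ν k i ≤ C₁ * V := by
    have := hsum ν k hk₁ (fun _ => 1) 1 (fun _ => zero_le_one) zero_le_one
      (fun m _ => by simp [card_cube]) Λ
    simpa using this
  have hstart : boxEnergy K U Λ (cubeWeight ν k) (y 0) ≤ B * (C₁ * M * V) :=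
    (boxEnergy_le hK hc Λ (cubeWeight_nonneg ν k)
      (fun _ _ => cubeWeight_le_of_siteDist_eq_one ν hk₁) (y 0)).trans <|
      mul_le_mul_of_nonneg_left (hsum ν k hk₁ _ M (hE 0) (zero_le_one.trans (hM.one_le hc hd))
        (fun m hm => hM ν m (hk.trans_le (mod_cast hm))) Λ) (zero_le_one.trans hB)
  have hinside : ∑ i ∈ cube ν k ∩ Λ, siteEnergy U (y t i) ≤
      2 * (Real.exp κ * (B * (C₁ * M * V) + t ^ 4 * (B * (C₁ * V)))) := by
    refine (sum_cube_inter_siteEnergy_le hK hc ν k Λ (y t)).trans ?_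
    gcongr
    refine (boxEnergy_le_exp_mul hK hc (cubeWeight_nonneg ν k)
      (fun _ _ => cubeWeight_le_of_siteDist_eq_one ν hk₁) hy).trans ?_
    gcongr
    exact hweight.trans (le_mul_of_one_le_left (by positivity) hB)
  have houtside : ∑ i ∈ cube ν k \ Λ, siteEnergy U (y t i) ≤ M * V := by
    refine le_trans ?_ (hM ν k hk)
    rw [Finset.sum_congr rfl fun i hi => by rw [hout i (Finset.mem_sdiff.1 hi).2]]
    exact Finset.sum_le_sum_of_subset_of_nonneg Finset.sdiff_subset fun i _ _ => hE 0 i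
  rw [← Finset.sum_inter_add_sum_sdiff (cube ν k) Λ]
  have : 0 ≤ t ^ 4 * V := by positivity
  linarith

end EnergyEstimate

/-! ### Stability -/

/-- The vector field `(p_j, F_j(x))` of the infinite system. -/
noncomputable def vecField (K : ℝ) (U : ℝ[X]) (j : Site d) (x : Config d) : ℝ × ℝ :=
  ((x j).2, force K U j x)

/-- The linear vector field of the system with `U = 0`. -/
noncomputable def harmonicField (K : ℝ) (j : Site d) : Config d →ₗ[ℝ] ℝ × ℝ where
  toFun x := ((x j).2, -K * ∑ k ∈ nbrs j, ((x j).1 - (x k).1))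
  map_add' x y := by
    simp only [Pi.add_apply, Prod.fst_add, Prod.snd_add, add_sub_add_comm,
      Finset.sum_add_distrib, mul_add, Prod.mk_add_mk]
  map_smul' a x := by
    simp only [Pi.smul_apply, Prod.smul_fst, Prod.smul_snd, smul_eq_mul, ← mul_sub,
      ← Finset.mul_sum, RingHom.id_apply, Prod.smul_mk, mul_left_comm]

section Stability

variable {K c M : ℝ} {U : ℝ[X]}

theorem isSolution_iff {x : ℝ → Config d} :
    IsSolution K U x ↔ ∀ t j, HasDerivAt (fun s => x s j) (vecField K U j (x t)) t :=
  ⟨fun h t j => (h t j).1.prodMk (h t j).2, fun h t j => ⟨(h t j).fst, (h t j).snd⟩⟩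

theorem harmonicField_apply (K : ℝ) (j : Site d) (x : Config d) :
    harmonicField K j x = ((x j).2, -K * ∑ k ∈ nbrs j, ((x j).1 - (x k).1)) :=
  rfl

theorem vecField_eq_harmonicField_sub (K : ℝ) (U : ℝ[X]) (j : Site d) (x : Config d) :
    vecField K U j x = harmonicField K j x - (0, (derivative U).eval (x j).1) := by
  rw [harmonicField_apply, vecField, force, Prod.mk_sub_mk, sub_zero]
  ring_nf

theorem norm_harmonicField_le (hK : 0 ≤ K) (j : Site d) (w : Config d) :
    ‖harmonicField K j w‖ ≤ (1 + K * (3 ^ d + 1)) * (‖w j‖ + ∑ k ∈ nbrs j, ‖w k‖) := by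
  set S := ∑ k ∈ nbrs j, ‖w k‖
  have hS : 0 ≤ S := Finset.sum_nonneg fun _ _ => norm_nonneg _
  have hN : 0 ≤ ‖w j‖ := norm_nonneg _
  have hsum : |∑ k ∈ nbrs j, ((w j).1 - (w k).1)| ≤ (3 ^ d + 1) * (‖w j‖ + S) :=
    calc |∑ k ∈ nbrs j, ((w j).1 - (w k).1)| ≤ ∑ k ∈ nbrs j, (‖w j‖ + ‖w k‖) :=
          (Finset.abs_sum_le_sum_abs _ _).trans <| Finset.sum_le_sum fun k _ =>
            (abs_sub _ _).trans (add_le_add (norm_fst_le (w j)) (norm_fst_le (w k)))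
      _ = (nbrs j).card * ‖w j‖ + S := by
          rw [Finset.sum_add_distrib, Finset.sum_const, nsmul_eq_mul]
      _ ≤ 3 ^ d * ‖w j‖ + S := by
          gcongr
          exact_mod_cast card_nbrs_le j
      _ ≤ (3 ^ d + 1) * (‖w j‖ + S) := by
          have : 0 ≤ 3 ^ d * S := by positivity
          linarith
  rw [harmonicField_apply, Prod.norm_def, max_le_iff]
  refine ⟨(norm_snd_le (w j)).trans ?_, ?_⟩
  · have : 0 ≤ K * (3 ^ d + 1) * (‖w j‖ + S) := by positivity
    linarith
  · rw [Real.norm_eq_abs, abs_mul, abs_neg, abs_of_nonneg hK]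
    have := mul_le_mul_of_nonneg_left hsum hK
    linarith

theorem EnergyBound.mul_siteEnergy_add_le (hc : GrowthBounds U c) (hd : 1 ≤ d) {x y : Config d}
    (hx : EnergyBound U M x) (hy : EnergyBound U M y) (j : Site d) :
    c * (siteEnergy U (x j) + siteEnergy U (y j)) ≤
      2 * (c * 5 ^ d * M) * Real.log (siteWeight j) := by
  have := mul_le_mul_of_nonneg_left
    (add_le_add (hx.siteEnergy_le hc hd j) (hy.siteEnergy_le hc hd j))
    (zero_le_one.trans hc.one_le)
  linarith

theorem EnergyBound.norm_le (hc : GrowthBounds U c) (hd : 1 ≤ d) {x : Config d}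
    (hx : EnergyBound U M x) (j : Site d) : ‖x j‖ ≤ c * 5 ^ d * M * siteWeight j := by
  have hc₀ : 0 ≤ c := zero_le_one.trans hc.one_le
  have hM : 0 ≤ M := zero_le_one.trans (hx.one_le hc hd)
  calc ‖x j‖ ≤ c * siteEnergy U (x j) := hc.norm_le _
    _ ≤ c * (5 ^ d * M * siteWeight j) := by
        gcongr
        refine (hx.siteEnergy_le hc hd j).trans ?_
        gcongr
        exact log_siteWeight_le j
    _ = _ := by ring

/-- The vector field is Lipschitz on the configurations with energy bound `M`, with this constant
times `log (e + |j|)` at the site `j`. -/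
noncomputable def lipConst (d : ℕ) (K c M : ℝ) : ℝ := 1 + K * (3 ^ d + 1) + 2 * (c * 5 ^ d * M)

theorem lipConst_nonneg (d : ℕ) (hK : 0 ≤ K) (hc : 1 ≤ c) (hM : 0 ≤ M) : 0 ≤ lipConst d K c M := by
  unfold lipConst
  positivity

theorem norm_harmonicField_sub_le (hK : 0 ≤ K) (hc : 1 ≤ c) (hM : 0 ≤ M) {j : Site d}
    {w : Config d} {a r : ℝ}
    (ha : |a| ≤ 2 * (c * 5 ^ d * M) * Real.log (siteWeight j) * ‖w j‖ + r) :
    ‖harmonicField K j w - (0, a)‖ ≤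
      lipConst d K c M * Real.log (siteWeight j) * (‖w j‖ + ∑ k ∈ nbrs j, ‖w k‖) + r := by
  have hL : 1 ≤ Real.log (siteWeight j) := one_le_log_siteWeight j
  set L := Real.log (siteWeight j)
  set S := ∑ k ∈ nbrs j, ‖w k‖
  have hS : 0 ≤ S := Finset.sum_nonneg fun _ _ => norm_nonneg _
  have hlinear : ‖harmonicField K j w‖ ≤ (1 + K * (3 ^ d + 1)) * L * (‖w j‖ + S) := by
    refine (norm_harmonicField_le hK j w).trans ?_
    gcongr
    exact le_mul_of_one_le_right (by positivity) hL
  have hself : 2 * (c * 5 ^ d * M) * L * ‖w j‖ ≤ 2 * (c * 5 ^ d * M) * L * (‖w j‖ + S) := by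
    gcongr
    exact le_add_of_nonneg_right hS
  calc ‖harmonicField K j w - (0, a)‖ ≤ ‖harmonicField K j w‖ + |a| :=
        (norm_sub_le _ _).trans_eq (by simp [Prod.norm_def])
    _ ≤ _ := add_le_add hlinear ha
    _ ≤ lipConst d K c M * L * (‖w j‖ + S) + r := by
        unfold lipConst
        linarith

theorem norm_vecField_sub_le (hK : 0 ≤ K) (hc : GrowthBounds U c) (hd : 1 ≤ d) {x y : Config d}
    (hx : EnergyBound U M x) (hy : EnergyBound U M y) (j : Site d) :
    ‖vecField K U j x - vecField K U j y‖ ≤ lipConst d K c M * Real.log (siteWeight j) *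
      (‖x j - y j‖ + ∑ k ∈ nbrs j, ‖x k - y k‖) := by
  have hforce : |(derivative U).eval (x j).1 - (derivative U).eval (y j).1| ≤
      2 * (c * 5 ^ d * M) * Real.log (siteWeight j) * ‖(x - y) j‖ + 0 := by
    rw [add_zero]
    have hE := hx.mul_siteEnergy_add_le hc hd hy j
    have hE₀ : 0 ≤ c * (siteEnergy U (x j) + siteEnergy U (y j)) :=
      mul_nonneg (zero_le_one.trans hc.one_le)
        (add_nonneg (hc.siteEnergy_nonneg _) (hc.siteEnergy_nonneg _))
    exact (hc.abs_deriv_sub_le (x j) (y j)).trans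
      (mul_le_mul hE (norm_fst_le (x j - y j)) (abs_nonneg _) (hE₀.trans hE))
  have hsplit : vecField K U j x - vecField K U j y = harmonicField K j (x - y) -
      (0, (derivative U).eval (x j).1 - (derivative U).eval (y j).1) := by
    rw [vecField_eq_harmonicField_sub, vecField_eq_harmonicField_sub, map_sub, sub_sub_sub_comm,
      Prod.mk_sub_mk 0 0, sub_zero]
  simpa [hsplit] using norm_harmonicField_sub_le hK hc.one_le
    (zero_le_one.trans (hx.one_le hc hd)) hforce

/-- The curve `x` stays among the configurations with energy bound `M` on the set of times `I`, and
solves the infinite system there up to an error of size `b (e + |j|) ^ α` at the site `j`. -/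
structure IsApproxSolution (K : ℝ) (U : ℝ[X]) (M b : ℝ) (α : ℕ) (I : Set ℝ) (x : ℝ → Config d) :
    Prop where
  energyBound : ∀ t ∈ I, EnergyBound U M (x t)
  differentiableAt : ∀ t ∈ I, ∀ j, DifferentiableAt ℝ (fun s => x s j) t
  norm_deriv_sub_le : ∀ t ∈ I, ∀ j,
    ‖deriv (fun s => x s j) t - vecField K U j (x t)‖ ≤ b * siteWeight j ^ α

theorem IsApproxSolution.of_hasDerivAt {b : ℝ} {α : ℕ} {I : Set ℝ} {x : ℝ → Config d}
    (hb : 0 ≤ b) (hE : ∀ t ∈ I, EnergyBound U M (x t))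
    (hx : ∀ t ∈ I, ∀ j, HasDerivAt (fun s => x s j) (vecField K U j (x t)) t) :
    IsApproxSolution K U M b α I x where
  energyBound := hE
  differentiableAt t ht j := (hx t ht j).differentiableAt
  norm_deriv_sub_le t ht j := by
    rw [(hx t ht j).deriv, sub_self, norm_zero]
    exact mul_nonneg hb (pow_nonneg (siteWeight_pos j).le _)

theorem norm_deriv_sub_le_of_isApproxSolution (hK : 0 ≤ K) (hc : GrowthBounds U c) (hd : 1 ≤ d)
    {b t : ℝ} {α : ℕ} {I : Set ℝ} {x y : ℝ → Config d} (hx : IsApproxSolution K U M b α I x)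
    (hy : IsApproxSolution K U M b α I y) (ht : t ∈ I) (j : Site d) :
    ‖deriv (fun r => x r j) t - deriv (fun r => y r j) t‖ ≤
      lipConst d K c M * Real.log (siteWeight j) *
        (‖x t j - y t j‖ + ∑ k ∈ nbrs j, ‖x t k - y t k‖) + 2 * b * siteWeight j ^ α := by
  have hvecField := norm_vecField_sub_le hK hc hd (hx.energyBound t ht) (hy.energyBound t ht) j
  have htriangle := norm_add₃_le (a := deriv (fun r => x r j) t - vecField K U j (x t))
    (b := vecField K U j (x t) - vecField K U j (y t))
    (c := vecField K U j (y t) - deriv (fun r => y r j) t)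
  rw [sub_add_sub_cancel, sub_add_sub_cancel, norm_sub_rev (vecField K U j (y t))] at htriangle
  linarith [hx.norm_deriv_sub_le t ht j, hy.norm_deriv_sub_le t ht j]

theorem exists_stability (hK : 0 ≤ K) (hc : GrowthBounds U c) (hd : 1 ≤ d) (hM : 0 ≤ M) {T : ℝ}
    (hT : 0 ≤ T) (α : ℕ) :
    ∃ (C : ℝ) (β : ℕ), 0 ≤ C ∧ ∀ (x y : ℝ → Config d) (b s t : ℝ), 0 ≤ b → |t - s| ≤ T →
      IsApproxSolution K U M b α (uIcc s t) x → IsApproxSolution K U M b α (uIcc s t) y →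
      (∀ j, ‖x s j - y s j‖ ≤ b * siteWeight j ^ α) →
      ∀ j, ‖x t j - y t j‖ ≤ C * b * siteWeight j ^ β := by
  obtain ⟨C, β, hC, hgronwall⟩ :=
    exists_weighted_gronwall d (lipConst_nonneg d hK hc.one_le hM) hT (α + 1)
  refine ⟨2 * C, β, by positivity, fun x y b s t hb hst hx hy hstart j => ?_⟩
  have hc₀ : 0 ≤ c := zero_le_one.trans hc.one_le
  have hpow : ∀ j : Site d, siteWeight j ^ α ≤ siteWeight j ^ (α + 1) := fun j =>
    pow_le_pow_right₀ (by linarith [two_le_siteWeight j]) α.le_succ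
  have hprior : ∀ r ∈ uIcc s t, ∀ j,
      ‖x r j - y r j‖ ≤ 2 * (c * 5 ^ d * M) * siteWeight j ^ (α + 1) := fun r hr j =>
    calc ‖x r j - y r j‖ ≤ ‖x r j‖ + ‖y r j‖ := norm_sub_le _ _
      _ ≤ 2 * (c * 5 ^ d * M) * siteWeight j := by
          linarith [(hx.energyBound r hr).norm_le hc hd j, (hy.energyBound r hr).norm_le hc hd j]
      _ ≤ _ := by
          gcongr
          exact le_self_pow₀ (by linarith [two_le_siteWeight j]) α.succ_ne_zero
  refine (hgronwall (fun r j => x r j - y r j) (fun r j => deriv (fun r => x r j) r -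
    deriv (fun r => y r j) r) (2 * b) _ s t (by positivity) hst
    (fun r hr j => (hx.differentiableAt r hr j).hasDerivAt.fun_sub
      (hy.differentiableAt r hr j).hasDerivAt)
    (fun j => (hstart j).trans ?_)
    (fun r hr j => (norm_deriv_sub_le_of_isApproxSolution hK hc hd hx hy hr j).trans ?_)
    hprior j).trans_eq (by ring)
  · exact mul_le_mul (by linarith) (hpow j) (pow_nonneg (siteWeight_pos j).le _) (by positivity)
  · exact add_le_add le_rfl (mul_le_mul_of_nonneg_left (hpow j) (by positivity))

theorem eq_of_energyBound (hK : 0 ≤ K) (hc : GrowthBounds U c) (hd : 1 ≤ d) {s t : ℝ}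
    {x y : ℝ → Config d} (hEx : ∀ r ∈ uIcc s t, EnergyBound U M (x r))
    (hEy : ∀ r ∈ uIcc s t, EnergyBound U M (y r))
    (hx : ∀ r ∈ uIcc s t, ∀ j, HasDerivAt (fun r => x r j) (vecField K U j (x r)) r)
    (hy : ∀ r ∈ uIcc s t, ∀ j, HasDerivAt (fun r => y r j) (vecField K U j (y r)) r)
    (hxy : x s = y s) : x t = y t := by
  have hM : 0 ≤ M := zero_le_one.trans ((hEx s left_mem_uIcc).one_le hc hd)
  obtain ⟨C, β, -, hstab⟩ := exists_stability hK hc hd hM (abs_nonneg (t - s)) 0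
  funext j
  simpa [sub_eq_zero] using hstab x y 0 s t le_rfl le_rfl (.of_hasDerivAt le_rfl hEx hx)
    (.of_hasDerivAt le_rfl hEy hy) (by simp [hxy]) j

end Stability

/-! ### Existence -/

theorem supDist_le_siteDist (i j : Site d) : (supDist i j : ℤ) ≤ siteDist j i := by
  have hsup : supDist i j ≤ (siteDist j i).toNat := by
    refine Finset.sup_le fun l _ => ?_
    have hl : |j l - i l| ≤ siteDist j i :=
      Finset.single_le_sum (f := fun l => |j l - i l|) (fun _ _ => abs_nonneg _)
        (Finset.mem_univ l)
    rw [Int.abs_eq_natAbs] at hl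
    omega
  have := siteDist_nonneg j i
  omega

theorem add_one_le_siteWeight {n : ℕ} {j : Site d} (h : n ≤ supDist 0 j) :
    (n : ℝ) + 1 ≤ siteWeight j := by
  have hdist : (n : ℝ) ≤ siteDist j 0 := by
    exact_mod_cast (Int.ofNat_le.2 h).trans (supDist_le_siteDist 0 j)
  have := Real.add_one_le_exp 1
  unfold siteWeight
  linarith

theorem boxForce_cube_eq_force (K : ℝ) (U : ℝ[X]) {n : ℕ} {j : Site d} (h : supDist 0 j < n)
    (x : Config d) : boxForce K U (cube 0 n) j x = force K U j x := by
  have hnbrs : (cube 0 n).filter (fun k => siteDist k j = 1) = nbrs j := by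
    ext k
    rw [Finset.mem_filter, mem_nbrs, mem_cube_iff_supDist_le, and_iff_right_iff_imp]
    exact fun hk => (supDist_le_of_siteDist_eq_one hk).trans h
  unfold boxForce force
  rw [hnbrs]

open Classical in
/-- The vector field of the dynamics in the cube of center `0` and side `2n+1`, all the other sites
being frozen. -/
noncomputable def boxField (K : ℝ) (U : ℝ[X]) (n : ℕ) (j : Site d) (x : Config d) : ℝ × ℝ :=
  if j ∈ cube 0 n then ((x j).2, boxForce K U (cube 0 n) j x) else 0

theorem boxField_eq_vecField (K : ℝ) (U : ℝ[X]) {n : ℕ} {j : Site d} (h : supDist 0 j < n)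
    (x : Config d) : boxField K U n j x = vecField K U j x := by
  rw [boxField, if_pos (mem_cube_iff_supDist_le.2 h.le), boxForce_cube_eq_force K U h, vecField]

/-- The vector fields of the dynamics in finite and infinite volume are bounded, on the
configurations with energy bound `M`, by this constant times `e + |j|` at the site `j`. -/
noncomputable def fieldConst (d : ℕ) (K c M : ℝ) : ℝ := c * 5 ^ d * M * (1 + K * 3 ^ d * 3)

section Existence

variable {K c M : ℝ} {U : ℝ[X]}

theorem fieldConst_nonneg (d : ℕ) (hK : 0 ≤ K) (hc : 1 ≤ c) (hM : 0 ≤ M) :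
    0 ≤ fieldConst d K c M := by
  unfold fieldConst
  positivity

theorem EnergyBound.norm_boxForce_le (hK : 0 ≤ K) (hc : GrowthBounds U c) (hd : 1 ≤ d)
    {x : Config d} (hx : EnergyBound U M x) (Λ : Finset (Site d)) (j : Site d) :
    ‖((x j).2, boxForce K U Λ j x)‖ ≤ fieldConst d K c M * siteWeight j := by
  have hc₀ : 0 ≤ c := zero_le_one.trans hc.one_le
  have hM : 0 ≤ M := zero_le_one.trans (hx.one_le hc hd)
  have hρ := two_le_siteWeight j
  have hnorm := fun k => hx.norm_le hc hd k
  unfold fieldConst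
  set B := c * 5 ^ d * M
  have : 0 ≤ B := by positivity
  have hderiv : |(derivative U).eval (x j).1| ≤ B * siteWeight j :=
    calc |(derivative U).eval (x j).1| ≤ c * siteEnergy U (x j) := hc.abs_deriv_le _
      _ ≤ c * (5 ^ d * M * siteWeight j) := by
          gcongr
          refine (hx.siteEnergy_le hc hd j).trans ?_
          gcongr
          exact log_siteWeight_le j
      _ = B * siteWeight j := by ring
  have hbond : ∀ k ∈ Λ.filter (fun k => siteDist k j = 1),
      |(x j).1 - (x k).1| ≤ B * (3 * siteWeight j) := fun k hk => by
    have hweight := siteWeight_le_of_mem_nbrs (mem_nbrs.2 (Finset.mem_filter.1 hk).2)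
    have : B * siteWeight k ≤ B * (2 * siteWeight j) := by
      gcongr
      linarith
    linarith [abs_sub (x j).1 (x k).1, (norm_fst_le (x j)).trans (hnorm j),
      (norm_fst_le (x k)).trans (hnorm k), Real.norm_eq_abs (x j).1, Real.norm_eq_abs (x k).1]
  have hsum : |∑ k ∈ Λ.filter (fun k => siteDist k j = 1), ((x j).1 - (x k).1)| ≤
      3 ^ d * (B * (3 * siteWeight j)) := by
    refine (Finset.abs_sum_le_sum_abs _ _).trans ((Finset.sum_le_card_nsmul _ _ _ hbond).trans ?_)
    rw [nsmul_eq_mul]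
    exact mul_le_mul_of_nonneg_right (mod_cast card_filter_siteDist_le _ _) (by positivity)
  rw [Prod.norm_def, max_le_iff, Real.norm_eq_abs (boxForce K U Λ j x)]
  refine ⟨(norm_snd_le (x j)).trans ?_, (abs_sub _ _).trans ?_⟩
  · have : 0 ≤ B * (K * 3 ^ d * 3) * siteWeight j := by positivity
    linarith [hnorm j]
  · rw [abs_neg, abs_mul, abs_of_nonneg hK]
    linarith [mul_le_mul_of_nonneg_left hsum hK]

theorem EnergyBound.norm_boxField_sub_vecField_le (hK : 0 ≤ K) (hc : GrowthBounds U c)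
    (hd : 1 ≤ d) {x : Config d} (hx : EnergyBound U M x) (n : ℕ) (j : Site d) :
    ‖boxField K U n j x - vecField K U j x‖ ≤
      2 * fieldConst d K c M / (n + 1) * siteWeight j ^ 2 := by
  have hbound := fun Λ => hx.norm_boxForce_le hK hc hd Λ j
  set B := fieldConst d K c M
  have hBρ : 0 ≤ B * siteWeight j := (norm_nonneg _).trans (hbound ∅)
  have hB : 0 ≤ B := nonneg_of_mul_nonneg_left hBρ (siteWeight_pos j)
  rcases lt_or_ge (supDist 0 j) n with h | h
  · rw [boxField_eq_vecField K U h, sub_self, norm_zero]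
    positivity
  have hbox : ‖boxField K U n j x‖ ≤ B * siteWeight j := by
    unfold boxField
    split_ifs
    · exact hbound _
    · rwa [norm_zero]
  have hvec : ‖vecField K U j x‖ ≤ B * siteWeight j := hbound (cube j 1)
  calc ‖boxField K U n j x - vecField K U j x‖ ≤ 2 * B * siteWeight j := by
        linarith [norm_sub_le (boxField K U n j x) (vecField K U j x)]
    _ ≤ 2 * B * (siteWeight j ^ 2 / (n + 1)) := by
        gcongr
        rw [le_div_iff₀ (by positivity), sq]
        exact mul_le_mul_of_nonneg_left (add_one_le_siteWeight h) (siteWeight_pos j).le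
    _ = _ := by ring

/-- The `n`-th curve `Y n` starts at `x`, follows the dynamics in the cube of center `0` and side
`2n+1` during the time interval `[-n, n]`, and has energy bound `B τ` up to the time `τ`. -/
structure IsCubeApproximation (K : ℝ) (U : ℝ[X]) (B : ℝ → ℝ) (x : Config d)
    (Y : ℕ → ℝ → Config d) : Prop where
  apply_zero : ∀ n, Y n 0 = x
  hasDerivAt : ∀ (n : ℕ) (t : ℝ), |t| ≤ n → ∀ j,
    HasDerivAt (fun s => Y n s j) (boxField K U n j (Y n t)) t
  energyBound : ∀ (n : ℕ) (τ t : ℝ), |t| ≤ τ → τ ≤ n → EnergyBound U (B τ) (Y n t)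

theorem exists_isCubeApproximation (hK : 0 ≤ K) (hc : GrowthBounds U c) (hd : 1 ≤ d) :
    ∃ C : ℝ, 1 ≤ C ∧ ∀ (M : ℝ) (x : Config d), EnergyBound U M x →
      ∃ Y, IsCubeApproximation K U (fun τ => C * (M + τ ^ 4)) x Y := by
  obtain ⟨C, hC, henergy⟩ := exists_box_energyBound (d := d) hK hc hd
  refine ⟨C, hC, fun M x hx => ?_⟩
  choose Y hstart hinside houtside using fun n : ℕ =>
    exists_box_solution hK hc (cube (0 : Site d) n) x (T := n + 1) (by positivity)
  have hinterval : ∀ {n : ℕ} {t : ℝ}, |t| ≤ n → t ∈ Ioo (-((n : ℝ) + 1)) (n + 1) := fun ht =>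
    abs_lt.1 (ht.trans_lt (lt_add_one _))
  refine ⟨Y, hstart, fun n t ht j => ?_, fun n τ t ht hτ => ?_⟩
  · unfold boxField
    split_ifs with hj
    · exact hinside n t (hinterval ht) j hj
    · simpa only [houtside n _ j hj] using hasDerivAt_const t (x j)
  · have hpow : t ^ 4 ≤ τ ^ 4 := by
      simpa only [(show Even 4 by decide).pow_abs] using pow_le_pow_left₀ (abs_nonneg t) ht 4
    refine (henergy (cube 0 n) (Y n) M t ((hstart n).symm ▸ hx) (fun s hs => ?_)
      fun i hi => by rw [houtside n t i hi, hstart]).mono (by gcongr)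
    have hst : |s| ≤ |t| := by simpa using abs_sub_left_of_mem_uIcc hs
    exact hinside n s (hinterval (hst.trans (ht.trans hτ)))

namespace IsCubeApproximation

variable {B : ℝ → ℝ} {x : Config d} {Y : ℕ → ℝ → Config d}

theorem isApproxSolution (hY : IsCubeApproximation K U B x Y) (hK : 0 ≤ K)
    (hc : GrowthBounds U c) (hd : 1 ≤ d) {n m : ℕ} (hnm : n ≤ m) {τ t : ℝ} (ht : |t| ≤ τ)
    (hτ : τ ≤ n) : IsApproxSolution K U (B τ) (2 * fieldConst d K c (B τ) / (n + 1)) 2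
      (uIcc 0 t) (Y m) := by
  have hτm : τ ≤ m := hτ.trans (mod_cast hnm)
  have habs : ∀ s ∈ uIcc 0 t, |s| ≤ τ := fun s hs =>
    le_trans (by simpa using abs_sub_left_of_mem_uIcc hs) ht
  refine ⟨fun s hs => hY.energyBound m τ s (habs s hs) hτm, fun s hs j =>
    (hY.hasDerivAt m s ((habs s hs).trans hτm) j).differentiableAt, fun s hs j => ?_⟩
  have hE := hY.energyBound m τ s (habs s hs) hτm
  have hB : 0 ≤ B τ := zero_le_one.trans (hE.one_le hc hd)
  have hfield := fieldConst_nonneg d hK hc.one_le hB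
  rw [(hY.hasDerivAt m s ((habs s hs).trans hτm) j).deriv]
  refine (hE.norm_boxField_sub_vecField_le hK hc hd m j).trans ?_
  have := siteWeight_pos j
  gcongr

theorem exists_norm_sub_le (hY : IsCubeApproximation K U B x Y) (hK : 0 ≤ K)
    (hc : GrowthBounds U c) (hd : 1 ≤ d) (j : Site d) (τ : ℕ) :
    ∃ R : ℝ, ∀ n m : ℕ, τ ≤ n → n ≤ m → ∀ t : ℝ, |t| ≤ τ →
      ‖Y n t j - Y m t j‖ ≤ R / (n + 1) := by
  have hB : 0 ≤ B τ := zero_le_one.trans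
    ((hY.energyBound τ τ 0 (by simp) le_rfl).one_le hc hd)
  have hfield := fieldConst_nonneg d hK hc.one_le hB
  obtain ⟨C, β, -, hstab⟩ := exists_stability hK hc hd hB τ.cast_nonneg 2
  refine ⟨C * (2 * fieldConst d K c (B τ)) * siteWeight j ^ β, fun n m hn hnm t ht => ?_⟩
  have hτ : (τ : ℝ) ≤ n := mod_cast hn
  have happrox := fun k (hk : n ≤ k) => hY.isApproxSolution hK hc hd hk ht hτ
  refine (hstab (Y n) (Y m) _ 0 t (by positivity) (by rwa [sub_zero]) (happrox n le_rfl)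
    (happrox m hnm) (fun k => ?_) j).trans_eq (by ring)
  rw [hY.apply_zero, hY.apply_zero, sub_self, norm_zero]
  have := siteWeight_pos k
  positivity

end IsCubeApproximation

theorem tendsto_const_div_add_one_atTop (R : ℝ) :
    Tendsto (fun n : ℕ => R / ((n : ℝ) + 1)) atTop (𝓝 0) := by
  simpa [Function.comp_def] using
    (tendsto_const_div_atTop_nhds_zero_nat R).comp (tendsto_add_atTop_nat 1)

theorem tendsto_of_norm_sub_le_div {E : Type*} [SeminormedAddCommGroup E] {f : ℕ → E} {a : E}
    {R : ℝ} {N : ℕ} (h : ∀ n, N ≤ n → ‖f n - a‖ ≤ R / (n + 1)) : Tendsto f atTop (𝓝 a) := by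
  refine tendsto_iff_norm_sub_tendsto_zero.2
    (squeeze_zero_norm' ?_ (tendsto_const_div_add_one_atTop R))
  filter_upwards [eventually_ge_atTop N] with n hn
  rw [norm_norm]
  exact h n hn

theorem exists_limit_of_norm_sub_le {E : Type*} [NormedAddCommGroup E] [CompleteSpace E]
    {f : ℕ → ℝ → E} (hf : ∀ τ : ℕ, ∃ R : ℝ, ∀ n m : ℕ, τ ≤ n → n ≤ m → ∀ t : ℝ, |t| ≤ τ →
      ‖f n t - f m t‖ ≤ R / (n + 1)) :
    ∃ g : ℝ → E, ∀ τ : ℕ, ∃ R : ℝ, ∀ n : ℕ, τ ≤ n → ∀ t : ℝ, |t| ≤ τ →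
      ‖f n t - g t‖ ≤ R / (n + 1) := by
  have hlim : ∀ t, ∃ l, Tendsto (fun n => f n t) atTop (𝓝 l) := fun t => by
    obtain ⟨R, hR⟩ := hf ⌈|t|⌉₊
    refine cauchySeq_tendsto_of_complete (Metric.cauchySeq_iff'.2 fun ε hε => ?_)
    obtain ⟨N, hN, hτ⟩ := (((tendsto_const_div_add_one_atTop R).eventually_lt_const hε).and
      (eventually_ge_atTop ⌈|t|⌉₊)).exists
    refine ⟨N, fun n hn => ?_⟩
    rw [dist_comm, dist_eq_norm]
    exact (hR N n hτ hn t (Nat.le_ceil _)).trans_lt hN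
  choose g hg using hlim
  refine ⟨g, fun τ => (hf τ).imp fun R hR n hn t ht => ?_⟩
  exact le_of_tendsto (tendsto_const_nhds.sub (hg t)).norm
    ((eventually_ge_atTop n).mono fun m hm => hR n m hn hm t ht)

namespace IsCubeApproximation

variable {B : ℝ → ℝ} {x : Config d} {Y : ℕ → ℝ → Config d} {y : ℝ → Config d}

theorem hasDerivAt_limit (hY : IsCubeApproximation K U B x Y) (hK : 0 ≤ K)
    (hc : GrowthBounds U c) (hd : 1 ≤ d) {τ : ℕ}
    (hEy : ∀ t : ℝ, |t| ≤ τ → EnergyBound U (B τ) (y t))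
    (hy : ∀ j, ∃ R : ℝ, ∀ n : ℕ, τ ≤ n → ∀ t : ℝ, |t| ≤ τ → ‖Y n t j - y t j‖ ≤ R / (n + 1))
    {t : ℝ} (ht : |t| < τ) (j : Site d) :
    HasDerivAt (fun s => y s j) (vecField K U j (y t)) t := by
  choose R hR using hy
  have hB : 0 ≤ B τ := zero_le_one.trans ((hEy t ht.le).one_le hc hd)
  have hlip : 0 ≤ lipConst d K c (B τ) * Real.log (siteWeight j) :=
    mul_nonneg (lipConst_nonneg d hK hc.one_le hB) (zero_le_one.trans (one_le_log_siteWeight j))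
  have hfield : ∀ n : ℕ, τ ≤ n → ∀ s : ℝ, |s| ≤ τ →
      ‖vecField K U j (Y n s) - vecField K U j (y s)‖ ≤
        lipConst d K c (B τ) * Real.log (siteWeight j) * (R j + ∑ k ∈ nbrs j, R k) / (n + 1) :=
    fun n hn s hs => by
      refine (norm_vecField_sub_le hK hc hd (hY.energyBound n τ s hs (mod_cast hn))
        (hEy s hs) j).trans ?_
      rw [mul_div_assoc, add_div, Finset.sum_div]
      gcongr with k
      · exact hR j n hn s hs
      · exact hR k n hn s hs
  refine hasDerivAt_of_tendstoUniformlyOn (l := atTop) (s := Ioo (-(τ : ℝ)) τ)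
    (f := fun n s => Y n s j) (f' := fun n s => vecField K U j (Y n s))
    (g' := fun s => vecField K U j (y s)) isOpen_Ioo ?_ ?_ (fun s hs => ?_) (abs_lt.1 ht)
  · refine Metric.tendstoUniformlyOn_iff.2 fun ε hε => ?_
    filter_upwards [(tendsto_const_div_add_one_atTop _).eventually_lt_const hε,
      eventually_ge_atTop τ] with n hn hτn s hs
    rw [dist_comm, dist_eq_norm]
    exact (hfield n hτn s (abs_lt.2 hs).le).trans_lt hn
  · filter_upwards [eventually_gt_atTop (supDist 0 j), eventually_ge_atTop τ] with n hj hτn s hs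
    rw [← boxField_eq_vecField K U hj]
    exact hY.hasDerivAt n s ((abs_lt.2 hs).le.trans (mod_cast hτn)) j
  · exact tendsto_of_norm_sub_le_div fun n hn => hR j n hn s (abs_lt.2 hs).le

theorem exists_limit (hY : IsCubeApproximation K U B x Y) (hK : 0 ≤ K) (hc : GrowthBounds U c)
    (hd : 1 ≤ d) : ∃ y : ℝ → Config d, y 0 = x ∧
      (∀ t j, HasDerivAt (fun s => y s j) (vecField K U j (y t)) t) ∧
      ∀ τ t : ℝ, |t| ≤ τ → EnergyBound U (B τ) (y t) := by
  choose y hy using fun j => exists_limit_of_norm_sub_le (hY.exists_norm_sub_le hK hc hd j)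
  have htendsto : ∀ t j, Tendsto (fun n => Y n t j) atTop (𝓝 (y j t)) := fun t j => by
    obtain ⟨R, hR⟩ := hy j ⌈|t|⌉₊
    exact tendsto_of_norm_sub_le_div fun n hn => hR n hn t (Nat.le_ceil _)
  have hE : ∀ τ t : ℝ, |t| ≤ τ → EnergyBound U (B τ) fun j => y j t := fun τ t ht => by
    refine .of_tendsto (htendsto t) ?_
    filter_upwards [tendsto_natCast_atTop_atTop.eventually_ge_atTop τ] with n hn
    exact hY.energyBound n τ t ht hn
  refine ⟨fun t j => y j t, ?_, fun t j => ?_, hE⟩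
  · funext j
    refine tendsto_nhds_unique (htendsto 0 j) ?_
    simp only [hY.apply_zero, tendsto_const_nhds]
  · obtain ⟨τ, hτ⟩ := exists_nat_gt |t|
    exact hY.hasDerivAt_limit hK hc hd (fun s hs => hE τ s hs) (fun k => hy k τ) hτ j

end IsCubeApproximation

theorem exists_solution (hK : 0 ≤ K) (hc : GrowthBounds U c) (hd : 1 ≤ d) :
    ∃ C : ℝ, 1 ≤ C ∧ ∀ (M : ℝ) (x : Config d), EnergyBound U M x →
      ∃ y : ℝ → Config d, y 0 = x ∧
        (∀ t j, HasDerivAt (fun s => y s j) (vecField K U j (y t)) t) ∧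
        ∀ τ t : ℝ, |t| ≤ τ → EnergyBound U (C * (M + τ ^ 4)) (y t) := by
  obtain ⟨C, hC, hex⟩ := exists_isCubeApproximation (d := d) hK hc hd
  refine ⟨C, hC, fun M x hx => ?_⟩
  obtain ⟨Y, hY⟩ := hex M x hx
  exact hY.exists_limit hK hc hd

end Existence

/-! ### Uniqueness -/

theorem isClosed_energyBound {U : ℝ[X]} {y : ℝ → Config d}
    (hy : ∀ j, Continuous fun t => y t j) (M : ℝ) : IsClosed {t | EnergyBound U M (y t)} := by
  simp only [EnergyBound, Set.ofPred_forall]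
  refine isClosed_iInter fun ν => isClosed_iInter fun k => isClosed_iInter fun _ => ?_
  exact isClosed_le (continuous_finsetSum _ fun i _ => (continuous_siteEnergy U).comp (hy i))
    continuous_const

section Uniqueness

variable {K c : ℝ} {U : ℝ[X]} {x y : ℝ → Config d}

theorem exists_energyBound_Icc (hK : 0 ≤ K) (hc : GrowthBounds U c) (hd : 1 ≤ d)
    (hy : ∀ t j, HasDerivAt (fun s => y s j) (vecField K U j (y t)) t)
    (hE : ∀ t, ∃ M, EnergyBound U M (y t)) (T : ℝ) :
    ∃ M, ∀ t ∈ Icc (-T) T, EnergyBound U M (y t) := by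
  obtain ⟨C, hC, hex⟩ := exists_solution (d := d) hK hc hd
  refine exists_bound_Icc_of_propagation (P := fun M t => EnergyBound U M (y t))
    (f := fun m r => C * (m + r ^ 4)) (fun _ _ _ hM h => h.mono hM)
    (isClosed_energyBound fun j => continuous_iff_continuousAt.2 fun t => (hy t j).continuousAt)
    hE (fun m r hr r' _ hrr' => ?_) (fun s t M m hM hm => ?_) T
  · have : 0 ≤ r := hr
    dsimp only
    gcongr
  obtain ⟨z, hz, hz', hEz⟩ := hex m (y s) hm
  have hyz : y t = z (t - s) := by
    refine eq_of_energyBound hK hc hd (M := max M (C * (m + |t - s| ^ 4)))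
      (y := fun r => z (r - s)) (fun r hr => (hM r hr).mono (le_max_left _ _)) (fun r hr => ?_)
      (fun r _ j => hy r j) (fun r _ j => (hz' (r - s) j).comp_sub_const r s) (by simp [hz])
    exact (hEz _ _ (abs_sub_left_of_mem_uIcc hr)).mono (le_max_right _ _)
  rw [hyz]
  exact hEz _ _ le_rfl

theorem solution_unique (hK : 0 ≤ K) (hc : GrowthBounds U c) (hd : 1 ≤ d)
    (hx : ∀ t j, HasDerivAt (fun s => x s j) (vecField K U j (x t)) t)
    (hy : ∀ t j, HasDerivAt (fun s => y s j) (vecField K U j (y t)) t)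
    (hEx : ∀ t, ∃ M, EnergyBound U M (x t)) (hEy : ∀ t, ∃ M, EnergyBound U M (y t))
    (h₀ : x 0 = y 0) : x = y := by
  funext t
  obtain ⟨M, hM⟩ := exists_energyBound_Icc hK hc hd hx hEx |t|
  obtain ⟨M', hM'⟩ := exists_energyBound_Icc hK hc hd hy hEy |t|
  have hIcc : ∀ r ∈ uIcc 0 t, r ∈ Icc (-|t|) |t| := fun r hr =>
    abs_le.1 (by simpa using abs_sub_left_of_mem_uIcc hr)
  exact eq_of_energyBound hK hc hd (M := max M M')
    (fun r hr => (hM r (hIcc r hr)).mono (le_max_left _ _))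
    (fun r hr => (hM' r (hIcc r hr)).mono (le_max_right _ _))
    (fun r _ => hx r) (fun r _ => hy r) h₀

end Uniqueness

/-! ### Differentiability in the initial condition -/

section Differentiability

variable {K c M : ℝ} {U : ℝ[X]}

theorem GrowthBounds.abs_deriv_second_difference_le (hc : GrowthBounds U c) {e δ : ℝ}
    {z : Fin 4 → ℝ × ℝ} (hz : ∀ m, siteEnergy U (z m) ≤ e) (hδ : ∀ m, ‖z m - z 0‖ ≤ δ) :
    |(derivative U).eval (z 3).1 - (derivative U).eval (z 1).1 - (derivative U).eval (z 2).1 +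
      (derivative U).eval (z 0).1| ≤ c * e * ‖z 3 - z 1 - z 2 + z 0‖ + 6 * (c * e) * δ ^ 2 := by
  have hc₀ : 0 ≤ c := zero_le_one.trans hc.one_le
  have he : 0 ≤ e := (hc.siteEnergy_nonneg _).trans (hz 0)
  have hw : |(z 3).1 - (z 1).1 - (z 2).1 + (z 0).1| ≤ ‖z 3 - z 1 - z 2 + z 0‖ :=
    norm_fst_le (z 3 - z 1 - z 2 + z 0)
  set V := fun q : ℝ => (derivative U).eval q
  set a := (derivative (derivative U)).eval (z 0).1
  have hlinear : |a * ((z 3).1 - (z 1).1 - (z 2).1 + (z 0).1)| ≤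
      c * e * ‖z 3 - z 1 - z 2 + z 0‖ := by
    rw [abs_mul]
    have : |a| ≤ c * e := (hc.abs_deriv_deriv_le (z 0)).trans (by gcongr; exact hz 0)
    gcongr
  have htaylor : ∀ m, |V (z m).1 - V (z 0).1 - a * ((z m).1 - (z 0).1)| ≤ 2 * (c * e) * δ ^ 2 :=
    fun m => by
      have hsq : ((z m).1 - (z 0).1) ^ 2 ≤ δ ^ 2 :=
        sq_le_sq' (abs_le.1 ((norm_fst_le (z m - z 0)).trans (hδ m))).1
          (abs_le.1 ((norm_fst_le (z m - z 0)).trans (hδ m))).2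
      calc _ ≤ c * (siteEnergy U (z 0) + siteEnergy U (z m)) * ((z m).1 - (z 0).1) ^ 2 :=
            hc.abs_deriv_taylor_le (z 0) (z m)
        _ ≤ c * (e + e) * δ ^ 2 := by
            gcongr
            exacts [hz 0, hz m]
        _ = _ := by ring
  simp only [abs_le] at hlinear htaylor ⊢
  constructor <;> linarith [htaylor 1, htaylor 2, htaylor 3]

theorem vecField_second_difference (K : ℝ) (U : ℝ[X]) (j : Site d) (x : Fin 4 → Config d) :
    vecField K U j (x 3) - vecField K U j (x 1) - vecField K U j (x 2) + vecField K U j (x 0) =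
      harmonicField K j (x 3 - x 1 - x 2 + x 0) -
        (0, (derivative U).eval (x 3 j).1 - (derivative U).eval (x 1 j).1 -
          (derivative U).eval (x 2 j).1 + (derivative U).eval (x 0 j).1) := by
  simp only [vecField_eq_harmonicField_sub, map_add, map_sub]
  ext <;> simp only [Prod.fst_sub, Prod.fst_add, Prod.snd_sub, Prod.snd_add] <;> ring

theorem norm_vecField_second_difference_le (hK : 0 ≤ K) (hc : GrowthBounds U c) (hd : 1 ≤ d)
    {x : Fin 4 → Config d} (hx : ∀ m, EnergyBound U M (x m)) {j : Site d} {δ : ℝ}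
    (hδ : ∀ m, ‖x m j - x 0 j‖ ≤ δ) :
    ‖vecField K U j (x 3) - vecField K U j (x 1) - vecField K U j (x 2) + vecField K U j (x 0)‖ ≤
      lipConst d K c M * Real.log (siteWeight j) * (‖x 3 j - x 1 j - x 2 j + x 0 j‖ +
        ∑ k ∈ nbrs j, ‖x 3 k - x 1 k - x 2 k + x 0 k‖) +
          6 * (c * 5 ^ d * M) * siteWeight j * δ ^ 2 := by
  have hM : 0 ≤ M := zero_le_one.trans ((hx 0).one_le hc hd)
  have hc₀ : 0 ≤ c := zero_le_one.trans hc.one_le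
  have hL : 1 ≤ Real.log (siteWeight j) := one_le_log_siteWeight j
  rw [vecField_second_difference]
  refine norm_harmonicField_sub_le hK hc.one_le hM <|
    (hc.abs_deriv_second_difference_le (z := fun m => x m j)
      (fun m => (hx m).siteEnergy_le hc hd j) hδ).trans (add_le_add ?_ ?_)
  · have : 0 ≤ c * 5 ^ d * M * Real.log (siteWeight j) * ‖x 3 j - x 1 j - x 2 j + x 0 j‖ := by
      positivity
    simp only [Pi.add_apply, Pi.sub_apply]
    linarith
  · calc _ = 6 * (c * 5 ^ d * M) * Real.log (siteWeight j) * δ ^ 2 := by ring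
      _ ≤ _ := by
        gcongr
        exact log_siteWeight_le j

theorem exists_norm_second_difference_le (hK : 0 ≤ K) (hc : GrowthBounds U c) (hd : 1 ≤ d)
    (hM : 0 ≤ M) {T : ℝ} (hT : 0 ≤ T) (α : ℕ) :
    ∃ (C : ℝ) (γ : ℕ), 0 ≤ C ∧ ∀ (x : Fin 4 → ℝ → Config d) (δ s t : ℝ), |t - s| ≤ T →
      (∀ m, ∀ r ∈ uIcc s t, EnergyBound U M (x m r)) →
      (∀ m, ∀ r ∈ uIcc s t, ∀ j, HasDerivAt (fun r => x m r j) (vecField K U j (x m r)) r) →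
      (∀ m, ∀ r ∈ uIcc s t, ∀ j, ‖x m r j - x 0 r j‖ ≤ δ * siteWeight j ^ α) →
      x 3 s - x 1 s - x 2 s + x 0 s = 0 →
      ∀ j, ‖x 3 t j - x 1 t j - x 2 t j + x 0 t j‖ ≤ C * δ ^ 2 * siteWeight j ^ γ := by
  obtain ⟨C, γ, hC, hgronwall⟩ := exists_weighted_gronwall d
    (lipConst_nonneg d hK hc.one_le hM) hT (2 * α + 1)
  have hc₀ : 0 ≤ c := zero_le_one.trans hc.one_le
  refine ⟨C * (6 * (c * 5 ^ d * M)), γ, by positivity,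
    fun x δ s t hst hE hx hδ hstart j => ?_⟩
  refine (hgronwall (fun r j => x 3 r j - x 1 r j - x 2 r j + x 0 r j)
    (fun r j => vecField K U j (x 3 r) - vecField K U j (x 1 r) - vecField K U j (x 2 r) +
      vecField K U j (x 0 r)) (6 * (c * 5 ^ d * M) * δ ^ 2) (4 * (c * 5 ^ d * M)) s t
    (by positivity) hst
    (fun r hr j => (((hx 3 r hr j).fun_sub (hx 1 r hr j)).fun_sub (hx 2 r hr j)).fun_add
      (hx 0 r hr j))
    (fun j => ?_) (fun r hr j => ?_) (fun r hr j => ?_) j).trans_eq (by ring)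
  · have hzero : x 3 s j - x 1 s j - x 2 s j + x 0 s j = 0 := congrFun hstart j
    have := siteWeight_pos j
    rw [hzero, norm_zero]
    positivity
  · exact (norm_vecField_second_difference_le (x := fun m => x m r) hK hc hd
      (fun m => hE m r hr) (fun m => hδ m r hr j)).trans_eq (by ring)
  · have hnorm := fun m => (hE m r hr).norm_le hc hd j
    calc ‖x 3 r j - x 1 r j - x 2 r j + x 0 r j‖
        ≤ ‖x 3 r j‖ + ‖x 1 r j‖ + ‖x 2 r j‖ + ‖x 0 r j‖ :=
          norm_add_le_of_le (norm_sub_le_of_le (norm_sub_le _ _) le_rfl) le_rfl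
      _ ≤ 4 * (c * 5 ^ d * M) * siteWeight j := by linarith [hnorm 0, hnorm 1, hnorm 2, hnorm 3]
      _ ≤ 4 * (c * 5 ^ d * M) * siteWeight j ^ (2 * α + 1) := by
          gcongr
          exact le_self_pow₀ (by linarith [two_le_siteWeight j]) (by lia)

theorem exists_norm_solution_sub_le (hK : 0 ≤ K) (hc : GrowthBounds U c) (hd : 1 ≤ d) {i : Site d}
    {x : Config d} {Y : ℝ × ℝ → ℝ → Config d} (hY₀ : ∀ z, Y z 0 = Function.update x i z)
    (hY : ∀ z t j, HasDerivAt (fun s => Y z s j) (vecField K U j (Y z t)) t) {z₀ : ℝ × ℝ}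
    {R T : ℝ} (hR : 0 ≤ R) (hT : 0 ≤ T)
    (hE : ∀ z, ‖z - z₀‖ ≤ R → ∀ t, |t| ≤ T → EnergyBound U M (Y z t)) :
    ∃ (C : ℝ) (β : ℕ), 0 ≤ C ∧ ∀ z, ‖z - z₀‖ ≤ R → ∀ t, |t| ≤ T → ∀ j,
      ‖Y z t j - Y z₀ t j‖ ≤ C * ‖z - z₀‖ * siteWeight j ^ β := by
  have hE₀ : ∀ t, |t| ≤ T → EnergyBound U M (Y z₀ t) := hE z₀ (by simpa using hR)
  have hM : 0 ≤ M := zero_le_one.trans ((hE₀ 0 (by simpa using hT)).one_le hc hd)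
  obtain ⟨C, β, hC, hstab⟩ := exists_stability hK hc hd hM hT 0
  refine ⟨C, β, hC, fun z hz t ht => ?_⟩
  have htime : ∀ r ∈ uIcc 0 t, |r| ≤ T := fun r hr => by
    simpa using (abs_sub_left_of_mem_uIcc hr).trans (by simpa using ht)
  refine hstab (Y z) (Y z₀) ‖z - z₀‖ 0 t (norm_nonneg _) (by simpa using ht)
    (.of_hasDerivAt (norm_nonneg _) (fun r hr => hE z hz r (htime r hr)) fun r _ => hY z r)
    (.of_hasDerivAt (norm_nonneg _) (fun r hr => hE₀ r (htime r hr)) fun r _ => hY z₀ r)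
    fun j => ?_
  rw [hY₀, hY₀, pow_zero, mul_one]
  rcases eq_or_ne j i with rfl | hj
  · simp
  · simp [hj]

theorem exists_norm_solution_second_difference_le (hK : 0 ≤ K) (hc : GrowthBounds U c)
    (hd : 1 ≤ d) {i : Site d} {x : Config d} {Y : ℝ × ℝ → ℝ → Config d}
    (hY₀ : ∀ z, Y z 0 = Function.update x i z)
    (hY : ∀ z t j, HasDerivAt (fun s => Y z s j) (vecField K U j (Y z t)) t) {z₀ : ℝ × ℝ}
    {R t : ℝ} (hR : 0 ≤ R) (hE : ∀ z, ‖z - z₀‖ ≤ R → ∀ s, |s| ≤ |t| → EnergyBound U M (Y z s)) :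
    ∃ (C : ℝ) (γ : ℕ), 0 ≤ C ∧ ∀ h k, ‖h‖ + ‖k‖ ≤ R → ∀ j,
      ‖Y (z₀ + h + k) t j - Y (z₀ + h) t j - Y (z₀ + k) t j + Y z₀ t j‖ ≤
        C * (‖h‖ + ‖k‖) ^ 2 * siteWeight j ^ γ := by
  have hM : 0 ≤ M := zero_le_one.trans ((hE z₀ (by simpa using hR) t le_rfl).one_le hc hd)
  obtain ⟨C₁, β, hC₁, hlip⟩ := exists_norm_solution_sub_le hK hc hd hY₀ hY hR (abs_nonneg t) hE
  obtain ⟨C₂, γ, hC₂, hsec⟩ := exists_norm_second_difference_le (d := d) hK hc hd hM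
    (abs_nonneg t) β
  refine ⟨C₂ * C₁ ^ 2, γ, by positivity, fun h k hhk j => ?_⟩
  let z : Fin 4 → ℝ × ℝ := ![z₀, z₀ + h, z₀ + k, z₀ + h + k]
  have hz : ∀ m, ‖z m - z₀‖ ≤ ‖h‖ + ‖k‖ := fun m => by
    fin_cases m
    · simpa [z] using add_nonneg (norm_nonneg h) (norm_nonneg k)
    · simp [z]
    · simp [z]
    · simpa [z, add_assoc] using norm_add_le h k
  have htime : ∀ r ∈ uIcc 0 t, |r| ≤ |t| := fun r hr => by
    simpa using abs_sub_left_of_mem_uIcc hr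
  have hstart : Y (z 3) 0 - Y (z 1) 0 - Y (z 2) 0 + Y (z 0) 0 = 0 := by
    ext1 l
    rcases eq_or_ne l i with rfl | hl
    · simp [hY₀, z]
    · simp [hY₀, hl]
  have hdist : ∀ m, ∀ r ∈ uIcc 0 t, ∀ l,
      ‖Y (z m) r l - Y z₀ r l‖ ≤ C₁ * (‖h‖ + ‖k‖) * siteWeight l ^ β := fun m r hr l => by
    have := siteWeight_pos l
    refine (hlip (z m) ((hz m).trans hhk) r (htime r hr) l).trans ?_
    gcongr
    exact hz m
  exact (hsec (fun m => Y (z m)) (C₁ * (‖h‖ + ‖k‖)) 0 t (by simp)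
    (fun m r hr => hE (z m) ((hz m).trans hhk) r (htime r hr)) (fun m r _ => hY (z m) r)
    hdist hstart j).trans_eq (by ring)

theorem differentiable_solution (hK : 0 ≤ K) (hc : GrowthBounds U c) (hd : 1 ≤ d) {i : Site d}
    {x : Config d} {Y : ℝ × ℝ → ℝ → Config d} (hY₀ : ∀ z, Y z 0 = Function.update x i z)
    (hY : ∀ z t j, HasDerivAt (fun s => Y z s j) (vecField K U j (Y z t)) t)
    (hE : ∀ (z₀ : ℝ × ℝ) (T : ℝ), ∃ M, ∀ z, ‖z - z₀‖ ≤ 2 → ∀ t, |t| ≤ T →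
      EnergyBound U M (Y z t)) (t : ℝ) (j : Site d) :
    Differentiable ℝ fun z => Y z t j := by
  intro z₀
  obtain ⟨M, hM⟩ := hE z₀ |t|
  obtain ⟨C₁, β, hC₁, hlip⟩ := exists_norm_solution_sub_le hK hc hd hY₀ hY zero_le_two
    (abs_nonneg t) hM
  obtain ⟨C₂, γ, hC₂, hsec⟩ := exists_norm_solution_second_difference_le hK hc hd hY₀ hY
    zero_le_two hM
  have hρ := siteWeight_pos j
  refine differentiableAt_of_norm_second_difference_le
    (C := C₁ * siteWeight j ^ β + C₂ * siteWeight j ^ γ) (fun h hh => ?_) fun h k hh hk => ?_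
  · have hbound := hlip (z₀ + h) (by simpa using hh.trans one_le_two) t le_rfl j
    rw [add_sub_cancel_left] at hbound
    have : 0 ≤ C₂ * siteWeight j ^ γ * ‖h‖ := by positivity
    linarith
  · have hbound := hsec h k (by linarith) j
    have : 0 ≤ C₁ * siteWeight j ^ β * (‖h‖ + ‖k‖) ^ 2 := by positivity
    linarith

end Differentiability

/-! ### The flow -/

/-- `Φ` solves the infinite system in `X₀` with the identity as initial condition, and an energy
bound grows along it at most like `t ^ 4`, with constant `C`. -/
structure IsBoundedFlow {K : ℝ} {U : ℝ[X]} (C : ℝ) (Φ : ℝ → X₀ d K U → X₀ d K U) : Prop where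
  map_zero : ∀ x, Φ 0 x = x
  isSolution : ∀ x, IsSolution K U fun t => (Φ t x : Config d)
  energyBound : ∀ {x : X₀ d K U} {M : ℝ}, EnergyBound U M x.1 →
    ∀ τ t : ℝ, |t| ≤ τ → EnergyBound U (C * (M + τ ^ 4)) (Φ t x : Config d)

section Flow

variable {K c C : ℝ} {U : ℝ[X]} {Φ : ℝ → X₀ d K U → X₀ d K U}

theorem eq_of_isSolution (hK : 0 ≤ K) (hc : GrowthBounds U c) (hd : 1 ≤ d) {x y : ℝ → X₀ d K U}
    (hx : IsSolution K U fun t => (x t : Config d)) (hy : IsSolution K U fun t => (y t : Config d))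
    (h₀ : x 0 = y 0) (t : ℝ) : x t = y t :=
  Subtype.ext <| congrFun (solution_unique hK hc hd (isSolution_iff.1 hx) (isSolution_iff.1 hy)
    (fun t => ⟨_, energyBound_toReal_Q hK hd (x t).2⟩)
    (fun t => ⟨_, energyBound_toReal_Q hK hd (y t).2⟩) (congrArg Subtype.val h₀)) t

theorem exists_isBoundedFlow (hK : 0 ≤ K) (hc : GrowthBounds U c) (hd : 1 ≤ d) :
    ∃ C : ℝ, 1 ≤ C ∧ ∃ Φ : ℝ → X₀ d K U → X₀ d K U, IsBoundedFlow C Φ := by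
  obtain ⟨C, hC, hex⟩ := exists_solution (d := d) hK hc hd
  have hglobal : ∀ (x : X₀ d K U) (M : ℝ), EnergyBound U M x.1 → ∃ y : ℝ → X₀ d K U, y 0 = x ∧
      IsSolution K U (fun t => (y t : Config d)) ∧
      ∀ τ t : ℝ, |t| ≤ τ → EnergyBound U (C * (M + τ ^ 4)) (y t : Config d) := fun x M hM => by
    obtain ⟨y, hy₀, hy, hE⟩ := hex M x.1 hM
    exact ⟨fun t => ⟨y t, (hE |t| t le_rfl).mem_X₀ hK hc⟩, Subtype.ext hy₀,
      isSolution_iff.2 hy, hE⟩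
  choose Y hY₀ hY _ using fun x : X₀ d K U => hglobal x _ (energyBound_toReal_Q hK hd x.2)
  refine ⟨C, hC, fun t x => Y x t, hY₀, hY, fun {x M} hM τ t ht => ?_⟩
  obtain ⟨y, hy₀, hy, hEy⟩ := hglobal x M hM
  rw [eq_of_isSolution hK hc hd (hY x) hy ((hY₀ x).trans hy₀.symm) t]
  exact hEy τ t ht

namespace IsBoundedFlow

theorem eq_apply (hΦ : IsBoundedFlow C Φ) (hK : 0 ≤ K) (hc : GrowthBounds U c) (hd : 1 ≤ d)
    {y : ℝ → X₀ d K U} (hy : IsSolution K U fun t => (y t : Config d)) (t : ℝ) :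
    y t = Φ t (y 0) :=
  eq_of_isSolution hK hc hd hy (hΦ.isSolution (y 0)) (hΦ.map_zero (y 0)).symm t

theorem map_add (hΦ : IsBoundedFlow C Φ) (hK : 0 ≤ K) (hc : GrowthBounds U c) (hd : 1 ≤ d)
    (s t : ℝ) (x : X₀ d K U) : Φ (s + t) x = Φ s (Φ t x) := by
  have hshift : IsSolution K U fun s => (Φ (s + t) x : Config d) := fun s j =>
    ⟨(hΦ.isSolution x (s + t) j).1.comp_add_const s t,
      (hΦ.isSolution x (s + t) j).2.comp_add_const s t⟩
  simpa using hΦ.eq_apply hK hc hd (y := fun s => Φ (s + t) x) hshift s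

theorem differentiable_updateAt (hΦ : IsBoundedFlow C Φ) (hK : 0 ≤ K) (hc : GrowthBounds U c)
    (hd : 1 ≤ d) (hC : 0 ≤ C) (t : ℝ) (x : X₀ d K U) (i j : Site d) :
    Differentiable ℝ fun z : ℝ × ℝ => (Φ t (updateAt x i z) : Config d) j := by
  refine differentiable_solution (x := x.1) (i := i) (Y := fun z t => Φ t (updateAt x i z))
    hK hc hd (fun z => congrArg Subtype.val (hΦ.map_zero _))
    (fun z => isSolution_iff.1 (hΦ.isSolution _)) (fun z₀ T => ?_) t j
  obtain ⟨B, hB⟩ := (isCompact_closedBall z₀ 2).bddAbove_image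
    (continuous_siteEnergy U).continuousOn
  refine ⟨C * ((Q K U x.1).toReal + B + T ^ 4), fun z hz t ht => ?_⟩
  have hzB : siteEnergy U z ≤ B := hB (mem_image_of_mem _ (mem_closedBall_iff_norm.2 hz))
  have hbound : EnergyBound U _ (updateAt x i z).1 :=
    (energyBound_toReal_Q hK hd x.2).update hc i z
  refine (hΦ.energyBound hbound T t ht).mono ?_
  gcongr

theorem Q_le (hΦ : IsBoundedFlow C Φ) (hK : 0 ≤ K) (hc : GrowthBounds U c) (hd : 1 ≤ d)
    (hC : 0 ≤ C) (t : ℝ) (x : X₀ d K U) :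
    Q K U (Φ t x : Config d) ≤ (((1 + 2 * K * c * 3 ^ d) * C * ((Q K U (x : Config d)).toReal *
      Real.log (Real.exp 1 + (Q K U (x : Config d)).toReal) + t ^ 4) : ℝ) : EReal) := by
  have hx := energyBound_toReal_Q hK hd x.2
  have hQ : 0 ≤ (Q K U x.1).toReal := zero_le_one.trans (hx.one_le hc hd)
  have hlog : 1 ≤ Real.log (Real.exp 1 + (Q K U x.1).toReal) := by
    rw [Real.le_log_iff_exp_le (by positivity)]
    exact le_add_of_nonneg_right hQ
  have hc₀ : 0 ≤ c := zero_le_one.trans hc.one_le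
  refine ((hΦ.energyBound hx |t| t le_rfl).Q_le hK hc).trans (EReal.coe_le_coe_iff.2 ?_)
  rw [← mul_assoc, (show Even 4 by decide).pow_abs]
  gcongr
  exact le_mul_of_one_le_right hQ hlog

end IsBoundedFlow

end Flow

end Anharmonic

open Anharmonic in
theorem theorem1_general (d : ℕ) (hd : 1 ≤ d) (K : ℝ) (hK : 0 ≤ K) (U : Polynomial ℝ)
    (hdeg : 4 ≤ U.natDegree) (hU : ∀ r : ℝ, 0 ≤ U.eval r) :
    ∃ Φ : ℝ → X₀ d K U → X₀ d K U,
      (∀ x, Φ 0 x = x) ∧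
      (∀ s t x, Φ (s + t) x = Φ s (Φ t x)) ∧
      (∀ x, IsSolution K U (fun t => (Φ t x : Config d))) ∧
      (∀ y : ℝ → X₀ d K U,
        IsSolution K U (fun t => (y t : Config d)) →
          ∀ t, y t = Φ t (y 0)) ∧
      (∀ (t : ℝ) (x : X₀ d K U) (i j : Site d),
        Differentiable ℝ
          (fun z : ℝ × ℝ => (Φ t (updateAt x i z) : Config d) j)) ∧
      ∃ C₀ : ℝ, 0 < C₀ ∧ ∀ (t : ℝ) (x : X₀ d K U),
        Q K U (Φ t x : Config d) ≤
          ((C₀ * ((Q K U (x : Config d)).toReal *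
              Real.log (Real.exp 1 + (Q K U (x : Config d)).toReal)
            + t ^ 4) : ℝ) : EReal) := by
  obtain ⟨c, hc⟩ := exists_growthBounds hdeg hU
  have hc₀ : 0 ≤ c := zero_le_one.trans hc.one_le
  obtain ⟨C, hC, Φ, hΦ⟩ := exists_isBoundedFlow (d := d) hK hc hd
  have hC₀ : 0 < C := zero_lt_one.trans_le hC
  exact ⟨Φ, hΦ.map_zero, hΦ.map_add hK hc hd, hΦ.isSolution, fun y hy => hΦ.eq_apply hK hc hd hy,
    hΦ.differentiable_updateAt hK hc hd hC₀.le, (1 + 2 * K * c * 3 ^ d) * C, by positivity,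
    hΦ.Q_le hK hc hd hC₀.le⟩

theorem theorem1 (d : ℕ) (hd : 1 ≤ d) (K : ℝ) (hK : 0 < K) (U : Polynomial ℝ)
    (hdeg : U.natDegree = 4) (hlead : 0 < U.leadingCoeff) (hU : ∀ r : ℝ, 0 ≤ U.eval r) :
    ∃ Φ : ℝ → Anharmonic.X₀ d K U → Anharmonic.X₀ d K U,
      -- one-parameter group
      (∀ x, Φ 0 x = x) ∧
      (∀ s t x, Φ (s + t) x = Φ s (Φ t x)) ∧
      -- existence and uniqueness of the global solution in `X₀`
      (∀ x, Anharmonic.IsSolution K U (fun t => (Φ t x : Anharmonic.Config d))) ∧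
      (∀ y : ℝ → Anharmonic.X₀ d K U,
        Anharmonic.IsSolution K U (fun t => (y t : Anharmonic.Config d)) →
          ∀ t, y t = Φ t (y 0)) ∧
      -- differentiability of `Φ_t(x)_j` with respect to `x_i`
      (∀ (t : ℝ) (x : Anharmonic.X₀ d K U) (i j : Anharmonic.Site d),
        Differentiable ℝ
          (fun z : ℝ × ℝ => (Φ t (Anharmonic.updateAt x i z) : Anharmonic.Config d) j)) ∧
      -- growth bound
      ∃ C₀ : ℝ, 0 < C₀ ∧ ∀ (t : ℝ) (x : Anharmonic.X₀ d K U),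
        Anharmonic.Q K U (Φ t x : Anharmonic.Config d) ≤
          ((C₀ * ((Anharmonic.Q K U (x : Anharmonic.Config d)).toReal *
              Real.log (Real.exp 1 + (Anharmonic.Q K U (x : Anharmonic.Config d)).toReal)
            + t ^ 4) : ℝ) : EReal) :=
  theorem1_general d hd K hK.le U hdeg.ge hU
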